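/- Let $n\ge 2$, let $(M,g)$ be a smooth $n$-dimensional Riemannian manifold with Levi-Civita connection $\nabla$ and curvature tensor $R(X,Y)Z=\nabla_X\nabla_YZ-\nabla_Y\nabla_XZ-\nabla_{[X,Y]}Z$, let $J\subset\mathbb R$ be an interval with more than one point, and let $\gamma\colon J\to M$ be a smooth curve parametrized by arclength with a smooth orthonormal Frenet frame $F_1=\gamma',F_2,\dots,F_n$ and smooth curvatures $k_1,\dots,k_{n-1}$: $$\nabla_{\gamma'}F_1=k_1F_2,\qquad \nabla_{\gamma'}F_i=-k_{i-1}F_{i-1}+k_iF_{i+1}\quad(2\le i\le n),$$ where $F_i=0$ for $i>n$ and $k_i=0$ for $i\ge n$. Assume $k_1>0$ on $J$, and let $p>0$. Put $$\mathcal E_p=\nabla_{\gamma'}\nabla_{\gamma'}\big(|\nabla_{\gamma'}\gamma'|^{p-2}\nabla_{\gamma'}\gamma'\big)-|\nabla_{\gamma'}\gamma'|^{p-2}R(\gamma',\nabla_{\gamma'}\gamma')\gamma'.$$ Call $\gamma$ $p$-biharmonic if $\mathcal E_p=0$, $p$-elastic if the component of $\mathcal E_p$ normal to $\gamma'$ vanishes,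 and proper biharmonic if $\mathcal E_2=0$ and $\gamma$ is not a geodesic. Consider the $p$-biharmonic system \begin{align*} 0&=(1-2p)k_1^{p-1}k_1',\\ 0&=(p-1)(p-2)k_1^{p-3}k_1'^2+(p-1)k_1^{p-2}k_1''-k_1^{p+1}-k_1^{p-1}k_2^2+k_1^{p-1}\langle R(F_1,F_2)F_2,F_1\rangle,\\ 0&=2(p-1)k_1^{p-2}k_1'k_2+k_1^{p-1}k_2'-k_1^{p-1}\langle R(F_1,F_2)F_1,F_3\rangle,\\ 0&=k_1^{p-1}k_2k_3-k_1^{p-1}\langle R(F_1,F_2)F_1,F_4\rangle,\\ 0&=k_1^{p-1}\langle R(F_1,F_2)F_1,F_j\rangle,\qquad j=5,\dots,n. \end{align*} Then $\gamma$ is $p$-biharmonic if and only if this system holds on $J$, and $p$-elastic if and only if the system without its first equation holds on $J$. Moreover: 1. If $p\ne\frac12$, the $p$-biharmonic system is equivalent to $$k_1=\mathrm{const}\ne0,\quad k_1^2+k_2^2=\langle R(F_1,F_2)F_2,F_1\rangle,\quad k_2'=\langle R(F_1,F_2)F_1,F_3\rangle,\quad k_2k_3=\langle R(F_1,F_2)F_1,F_4\rangle,\quad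 \langle R(F_1,F_2)F_1,F_j\rangle=0\ (5\le j\le n),$$ and this system holds if and only if $\gamma$ is a proper biharmonic curve. 2. If $p=\frac12$, the first equation of the $p$-biharmonic system always holds, and the $p$-biharmonic system is equivalent to \begin{align*} &\tfrac34k_1^{-1}k_1'^2-\tfrac12k_1''-k_1^3-k_1k_2^2+k_1\langle R(F_1,F_2)F_2,F_1\rangle=0,\\ &-k_1'k_2+k_1k_2'-k_1\langle R(F_1,F_2)F_1,F_3\rangle=0,\\ &k_2k_3-\langle R(F_1,F_2)F_1,F_4\rangle=0,\qquad \langle R(F_1,F_2)F_1,F_j\rangle=0\ (5\le j\le n), \end{align*} which holds if and only if $\gamma$ is $\frac12$-elastic. Finally, the case $p=\frac12$ does allow non-constant geodesic curvature: for every $n\ge2$ there is a smooth unit-speed curve $\gamma\colon\mathbb R\to\mathbb R^n$ in flat Euclidean space, with a Frenet frame with $k_1>0$, that is $\frac12$-biharmonic, satisfies the system in 2, and has non-constant $k_1$. -/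

import Mathlib

open Bundle FiberBundle Set
open scoped Manifold ContDiff

namespace PBiharmonic

noncomputable section

/-- The model space `ℝⁿ` of `n`-dimensional manifolds. -/
abbrev Rn (n : ℕ) : Type := EuclideanSpace ℝ (Fin n)

/-- The tangent bundle of an `n`-dimensional manifold, as a family of vector spaces. -/
abbrev Tan (n : ℕ) (M : Type*) [TopologicalSpace M] [ChartedSpace (Rn n) M] : M → Type :=
  fun x => TangentSpace (𝓡 n) x

section Manifold

variable {n : ℕ} {M : Type*} [TopologicalSpace M] [ChartedSpace (Rn n) M] [IsManifold (𝓡 n) ∞ M]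

/-- A connection on the tangent bundle of `M`. In Mathlib's convention `∇ Y x v` is `∇_v Y` at the
point `x`. -/
abbrev Connection (n : ℕ) (M : Type*) [TopologicalSpace M] [ChartedSpace (Rn n) M]
    [IsManifold (𝓡 n) ∞ M] : Type _ :=
  CovariantDerivative (𝓡 n) (Rn n) (Tan n M)

set_option synthInstance.maxHeartbeats 400000 in
/-- `∇` is the Levi-Civita connection of the Riemannian manifold `M`: a smooth connection that is
torsion-free and compatible with the metric. -/
structure IsLeviCivita [RiemannianBundle (Tan n M)]
    [IsContMDiffRiemannianBundle (𝓡 n) ∞ (Rn n) (Tan n M)] (nabla : Connection n M) : Prop where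
  smooth : CovariantDerivative.ContMDiffCovariantDerivative nabla ∞
  torsion_free : nabla.torsion = 0
  metric : nabla.IsMetricCompatible

/-- The Riemann curvature tensor
`R(u, v) w = ∇_X ∇_Y Z - ∇_Y ∇_X Z - ∇_[X, Y] Z`, evaluated at `x` on vector fields `X`, `Y`, `Z`
that are smooth near `x` and take the values `u`, `v`, `w` there. (The value is independent of the
chosen extensions; we take those which are constant in the preferred trivialization at `x`.) -/
def curvature (nabla : Connection n M) (x : M) (u v w : TangentSpace (𝓡 n) x) :
    TangentSpace (𝓡 n) x :=
  let X : (y : M) → TangentSpace (𝓡 n) y := extend (Rn n) u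
  let Y : (y : M) → TangentSpace (𝓡 n) y := extend (Rn n) v
  let Z : (y : M) → TangentSpace (𝓡 n) y := extend (Rn n) w
  nabla (fun y => nabla Z y (Y y)) x (X x) - nabla (fun y => nabla Z y (X y)) x (Y x)
    - nabla Z x (VectorField.mlieBracket (𝓡 n) X Y x)

/-- The velocity `γ'` of a curve `γ` defined on the interval `J`. -/
def velocity (n : ℕ) {M : Type*} [TopologicalSpace M] [ChartedSpace (Rn n) M]
    (J : Set ℝ) (γ : ℝ → M) (s : ℝ) : TangentSpace (𝓡 n) (γ s) :=
  mfderivWithin 𝓘(ℝ, ℝ) (𝓡 n) γ J s (1 : ℝ)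

/-- The covariant derivative `∇_{γ'} V` of a vector field `V` along the curve `γ`. With `eᵢ` the
coordinate frame of the preferred trivialization at the point `γ s` and `V = ∑ Vⁱ eᵢ` along `γ`,
it is `∑ (Vⁱ)' eᵢ + ∑ Vⁱ ∇_{γ'} eᵢ`; the second sum is `∇_{γ'}` applied to the local field
`extend (V s)`, whose coefficients in the frame are the constants `Vⁱ(s)`. -/
def covDerivAlong (nabla : Connection n M) (J : Set ℝ) (γ : ℝ → M)
    (V : (s : ℝ) → TangentSpace (𝓡 n) (γ s)) (s : ℝ) : TangentSpace (𝓡 n) (γ s) :=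
  (trivializationAt (Rn n) (Tan n M) (γ s)).symm (γ s)
      (derivWithin
        (fun t => ((trivializationAt (Rn n) (Tan n M) (γ s)) ⟨γ t, V t⟩).2) J s)
    + nabla (extend (Rn n) (V s)) (γ s) (velocity n J γ s)

/-- The tension field `τ(γ) = ∇_{γ'} γ'`. -/
def tension (nabla : Connection n M) (J : Set ℝ) (γ : ℝ → M) (s : ℝ) : TangentSpace (𝓡 n) (γ s) :=
  covDerivAlong nabla J γ (velocity n J γ) s

/-- `γ` is a geodesic on `J`. -/
def IsGeodesic (nabla : Connection n M) (J : Set ℝ) (γ : ℝ → M) : Prop :=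
  ∀ s ∈ J, tension nabla J γ s = 0

variable [RiemannianBundle (Tan n M)]

/-- `γ` is a smooth curve on `J` parametrized by arclength. -/
def IsUnitSpeed (n : ℕ) {M : Type*} [TopologicalSpace M] [ChartedSpace (Rn n) M]
    [RiemannianBundle (Tan n M)] (J : Set ℝ) (γ : ℝ → M) : Prop :=
  ContMDiffOn 𝓘(ℝ, ℝ) (𝓡 n) ∞ γ J ∧ ∀ s ∈ J, ‖velocity n J γ s‖ = 1

/-- `∇_{γ'} ∇_{γ'} (|∇_{γ'} γ'|^{p-2} ∇_{γ'} γ') - |∇_{γ'} γ'|^{p-2} R(γ', ∇_{γ'} γ') γ'`. -/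
def eulerLagrange (nabla : Connection n M) (p : ℝ) (J : Set ℝ) (γ : ℝ → M) (s : ℝ) :
    TangentSpace (𝓡 n) (γ s) :=
  covDerivAlong nabla J γ
      (covDerivAlong nabla J γ (fun t => ‖tension nabla J γ t‖ ^ (p - 2) • tension nabla J γ t)) s
    - ‖tension nabla J γ s‖ ^ (p - 2) •
      curvature nabla (γ s) (velocity n J γ s) (tension nabla J γ s) (velocity n J γ s)

/-- The Euler-Lagrange equation of `(1/p) ∫ |τ(γ)|^p ds`. -/
def IsPBiharmonic (nabla : Connection n M) (p : ℝ) (J : Set ℝ) (γ : ℝ → M) : Prop :=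
  ∀ s ∈ J, eulerLagrange nabla p J γ s = 0

/-- The equation for `p`-elastic curves, for a curve parametrized by arclength: the component of
the Euler-Lagrange expression that is normal to the curve vanishes. -/
def IsPElastic (nabla : Connection n M) (p : ℝ) (J : Set ℝ) (γ : ℝ → M) : Prop :=
  ∀ s ∈ J, eulerLagrange nabla p J γ s
    - inner ℝ (eulerLagrange nabla p J γ s) (velocity n J γ s) • velocity n J γ s = 0

/-- A proper biharmonic curve: a biharmonic curve (`p = 2`) that is not a geodesic. -/
def IsProperBiharmonic (nabla : Connection n M) (J : Set ℝ) (γ : ℝ → M) : Prop :=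
  IsPBiharmonic nabla 2 J γ ∧ ¬ IsGeodesic nabla J γ

/-- `F 1, …, F n` is a Frenet frame along `γ` with curvatures `k 1, …, k (n - 1)`: a smooth
orthonormal frame along `γ` that satisfies the Frenet equations. As a convention, `F i = 0` for
`i ∉ {1, …, n}` and `k i = 0` for `i ∉ {1, …, n - 1}`; this makes the last Frenet equation a special
case of the middle ones and removes from the systems below the terms that do not exist in low
dimensions. -/
structure IsFrenetFrame (nabla : Connection n M) (J : Set ℝ) (γ : ℝ → M)
    (F : ℕ → (s : ℝ) → TangentSpace (𝓡 n) (γ s)) (k : ℕ → ℝ → ℝ) : Prop where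
  smooth_frame : ∀ i, 1 ≤ i → i ≤ n →
    ContMDiffOn 𝓘(ℝ, ℝ) (𝓡 n).tangent ∞
      (fun s => (⟨γ s, F i s⟩ : TangentBundle (𝓡 n) M)) J
  smooth_curvature : ∀ i, 1 ≤ i → i < n → ContDiffOn ℝ ∞ (k i) J
  orthonormal : ∀ s ∈ J, ∀ i j, 1 ≤ i → i ≤ n → 1 ≤ j → j ≤ n →
    inner ℝ (F i s) (F j s) = if i = j then (1 : ℝ) else 0
  frame_eq_zero : ∀ i s, i = 0 ∨ n < i → F i s = 0
  curvature_eq_zero : ∀ i s, i = 0 ∨ n ≤ i → k i s = 0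
  frame_one : ∀ s ∈ J, F 1 s = velocity n J γ s
  deriv_one : ∀ s ∈ J, covDerivAlong nabla J γ (F 1) s = k 1 s • F 2 s
  deriv : ∀ s ∈ J, ∀ i, 2 ≤ i → i ≤ n →
    covDerivAlong nabla J γ (F i) s = -(k (i - 1) s) • F (i - 1) s + k i s • F (i + 1) s

/-- The curvature component `⟨R(F_a, F_b) F_c, F_d⟩` along `γ`. -/
def curvatureComponent (nabla : Connection n M) (γ : ℝ → M)
    (F : ℕ → (s : ℝ) → TangentSpace (𝓡 n) (γ s)) (a b c d : ℕ) (s : ℝ) : ℝ :=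
  inner ℝ (curvature nabla (γ s) (F a s) (F b s) (F c s)) (F d s)

/-- The tangential (first) equation `(1 - 2p) k₁^{p-1} k₁' = 0` of the `p`-biharmonic system. -/
def TangentialEquation (p : ℝ) (J : Set ℝ) (k : ℕ → ℝ → ℝ) : Prop :=
  ∀ s ∈ J, 0 = (1 - 2 * p) * k 1 s ^ (p - 1) * derivWithin (k 1) J s

/-- The `p`-elastic system: the normal equations of the `p`-biharmonic system. -/
structure PElasticSystem (nabla : Connection n M) (p : ℝ) (J : Set ℝ) (γ : ℝ → M)
    (F : ℕ → (s : ℝ) → TangentSpace (𝓡 n) (γ s)) (k : ℕ → ℝ → ℝ) : Prop where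
  eq_two : ∀ s ∈ J,
    0 = (p - 1) * (p - 2) * k 1 s ^ (p - 3) * derivWithin (k 1) J s ^ 2
      + (p - 1) * k 1 s ^ (p - 2) * derivWithin (derivWithin (k 1) J) J s
      - k 1 s ^ (p + 1) - k 1 s ^ (p - 1) * k 2 s ^ 2
      + k 1 s ^ (p - 1) * curvatureComponent nabla γ F 1 2 2 1 s
  eq_three : ∀ s ∈ J,
    0 = 2 * (p - 1) * k 1 s ^ (p - 2) * derivWithin (k 1) J s * k 2 s
      + k 1 s ^ (p - 1) * derivWithin (k 2) J s
      - k 1 s ^ (p - 1) * curvatureComponent nabla γ F 1 2 1 3 s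
  eq_four : ∀ s ∈ J,
    0 = k 1 s ^ (p - 1) * k 2 s * k 3 s
      - k 1 s ^ (p - 1) * curvatureComponent nabla γ F 1 2 1 4 s
  eq_rest : ∀ s ∈ J, ∀ j, 5 ≤ j → j ≤ n →
    0 = k 1 s ^ (p - 1) * curvatureComponent nabla γ F 1 2 1 j s

/-- The `p`-biharmonic system in terms of the Frenet frame. -/
def PBiharmonicSystem (nabla : Connection n M) (p : ℝ) (J : Set ℝ) (γ : ℝ → M)
    (F : ℕ → (s : ℝ) → TangentSpace (𝓡 n) (γ s)) (k : ℕ → ℝ → ℝ) : Prop :=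
  TangentialEquation p J k ∧ PElasticSystem nabla p J γ F k

/-- The system that characterizes proper biharmonic curves. -/
structure ProperBiharmonicSystem (nabla : Connection n M) (J : Set ℝ) (γ : ℝ → M)
    (F : ℕ → (s : ℝ) → TangentSpace (𝓡 n) (γ s)) (k : ℕ → ℝ → ℝ) : Prop where
  eq_one : ∃ c : ℝ, c ≠ 0 ∧ ∀ s ∈ J, k 1 s = c
  eq_two : ∀ s ∈ J, k 1 s ^ 2 + k 2 s ^ 2 = curvatureComponent nabla γ F 1 2 2 1 s
  eq_three : ∀ s ∈ J, derivWithin (k 2) J s = curvatureComponent nabla γ F 1 2 1 3 s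
  eq_four : ∀ s ∈ J, k 2 s * k 3 s = curvatureComponent nabla γ F 1 2 1 4 s
  eq_rest : ∀ s ∈ J, ∀ j, 5 ≤ j → j ≤ n → curvatureComponent nabla γ F 1 2 1 j s = 0

/-- The system for `p = 1/2`. -/
structure HalfSystem (nabla : Connection n M) (J : Set ℝ) (γ : ℝ → M)
    (F : ℕ → (s : ℝ) → TangentSpace (𝓡 n) (γ s)) (k : ℕ → ℝ → ℝ) : Prop where
  eq_one : ∀ s ∈ J,
    3 / 4 * (k 1 s)⁻¹ * derivWithin (k 1) J s ^ 2
      - 1 / 2 * derivWithin (derivWithin (k 1) J) J s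
      - k 1 s ^ 3 - k 1 s * k 2 s ^ 2 + k 1 s * curvatureComponent nabla γ F 1 2 2 1 s = 0
  eq_two : ∀ s ∈ J,
    -derivWithin (k 1) J s * k 2 s + k 1 s * derivWithin (k 2) J s
      - k 1 s * curvatureComponent nabla γ F 1 2 1 3 s = 0
  eq_three : ∀ s ∈ J, k 2 s * k 3 s - curvatureComponent nabla γ F 1 2 1 4 s = 0
  eq_rest : ∀ s ∈ J, ∀ j, 5 ≤ j → j ≤ n → curvatureComponent nabla γ F 1 2 1 j s = 0

end Manifold

end

end PBiharmonic

/-!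
The argument is a computation in the Frenet frame. Along the curve one has `∇_{γ'} γ' = k₁ F₂`, so
the field `|∇_{γ'} γ'|^{p-2} ∇_{γ'} γ'` equals `a F₂` with `a = k₁^{p-1}`. Two applications of the
Leibniz rule (`covDerivAlong_smul`) and of the Frenet equations express `∇_{γ'} ∇_{γ'} (a F₂)` in
terms of `F₁, …, F₄` (`IsFrenetFrame.covDerivAlong_covDerivAlong_smul_frame_two`). As
`R(u, v) w` is linear in `v` (`curvature_smul_mid`), the curvature term is `a R(F₁, F₂) F₁`. This
gives the Euler-Lagrange expression `𝓔` (`IsFrenetFrame.eulerLagrange_eq`); since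
`F₁(s), …, F_n(s)` is an orthonormal basis, `𝓔 = 0` (or the vanishing of its normal part) amounts to
the vanishing of its components. The operator `R(F₁, F₂)` of a metric connection is skew-adjoint
(`inner_curvature_skew`), so there is no curvature term in the tangential component, and the one in
the `F₂`-component is `-⟨R(F₁, F₂) F₂, F₁⟩`.

Skew-adjointness is obtained by differentiating `⟨Z, W⟩` twice. This needs that the Lie bracket of
vector fields acts on functions as the commutator of derivations (`mvfderiv_mlieBracket`), and that
`∇_X Z` is smooth near a point where `X` and `Z` are (`SmoothNear.nabla`, by a cut-off).

For `p ≠ 1/2` the tangential equation forces `k₁' = 0`, and the powers of the constant `k₁` cancel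
from the other equations. The resulting system does not involve `p`, so it also describes the case
`p = 2`, that of biharmonic curves. For `p = 1/2` the tangential equation is void.

The example with non-constant curvature is a planar catenary. For a planar curve in flat space the
system for `p = 1/2` is `¾ k₁'² / k₁ - ½ k₁'' - k₁³ = 0`. The substitution `k₁ = u⁻²` turns this
into `u'' = u⁻³`, which is solved by `u = √(1 + s²)`; the curve with `k₁ = 1 / (1 + s²)` is the
catenary `(arsinh s, √(1 + s²))`.
-/

namespace PBiharmonic

/-! ### Covariant derivatives along curves -/

section Along

variable {n : ℕ} {M : Type*} [TopologicalSpace M] [ChartedSpace (Rn n) M] [IsManifold (𝓡 n) ∞ M]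

lemma baseSet_mem_nhds (x : M) : (trivializationAt (Rn n) (Tan n M) x).baseSet ∈ nhds x :=
  (trivializationAt (Rn n) (Tan n M) x).open_baseSet.mem_nhds
    (FiberBundle.mem_baseSet_trivializationAt' (F := Rn n) (E := Tan n M) x)

/-- The extension `extend` is linear only near the base point: outside the domain of the
trivialization its values carry no meaning. -/
lemma extend_const_smul {x : M} (c : ℝ) (v : TangentSpace (𝓡 n) x) :
    ∀ᶠ y in nhds x, (extend (Rn n) (c • v) : (y : M) → TangentSpace (𝓡 n) y) y
      = (c • extend (Rn n) v : (y : M) → TangentSpace (𝓡 n) y) y := by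
  have hx := FiberBundle.mem_baseSet_trivializationAt' (F := Rn n) (E := Tan n M) x
  have h := ((trivializationAt (Rn n) (Tan n M) x).linear ℝ hx).map_smul c v
  filter_upwards [baseSet_mem_nhds (n := n) x] with y hy
  simp only [extend, Pi.smul_apply]
  erw [h, ← (trivializationAt (Rn n) (Tan n M) x).symmL_apply (R := ℝ) hy,
    ← (trivializationAt (Rn n) (Tan n M) x).symmL_apply (R := ℝ) hy, map_smul]

/-- The additive counterpart of `extend_const_smul`, again only near the base point. -/
lemma extend_add {x : M} (v w : TangentSpace (𝓡 n) x) :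
    ∀ᶠ y in nhds x, (extend (Rn n) (v + w) : (y : M) → TangentSpace (𝓡 n) y) y
      = (extend (Rn n) v + extend (Rn n) w : (y : M) → TangentSpace (𝓡 n) y) y := by
  have hx := FiberBundle.mem_baseSet_trivializationAt' (F := Rn n) (E := Tan n M) x
  have h := ((trivializationAt (Rn n) (Tan n M) x).linear ℝ hx).map_add v w
  filter_upwards [baseSet_mem_nhds (n := n) x] with y hy
  simp only [extend, Pi.add_apply]
  erw [h, ← (trivializationAt (Rn n) (Tan n M) x).symmL_apply (R := ℝ) hy,
    ← (trivializationAt (Rn n) (Tan n M) x).symmL_apply (R := ℝ) hy,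
    ← (trivializationAt (Rn n) (Tan n M) x).symmL_apply (R := ℝ) hy, map_add]

lemma nabla_extend_const_smul (nabla : Connection n M) {x : M} (c : ℝ)
    (v : TangentSpace (𝓡 n) x) :
    nabla (extend (Rn n) (c • v)) x = c • nabla (extend (Rn n) v) x := by
  have hv := mdifferentiableAt_extend (𝓡 n) (Rn n) (V := Tan n M) v
  rw [← nabla.isCovariantDerivativeOnUniv.smul_const c hv]
  exact nabla.isCovariantDerivativeOnUniv.congr_of_eventuallyEq
    (mdifferentiableAt_extend ..) (mdifferentiableAt_const.smul_section hv) Filter.univ_mem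
    (extend_const_smul c v)

lemma nabla_extend_add (nabla : Connection n M) {x : M} (v w : TangentSpace (𝓡 n) x) :
    nabla (extend (Rn n) (v + w)) x = nabla (extend (Rn n) v) x + nabla (extend (Rn n) w) x := by
  have hv := mdifferentiableAt_extend (𝓡 n) (Rn n) (V := Tan n M) v
  have hw := mdifferentiableAt_extend (𝓡 n) (Rn n) (V := Tan n M) w
  rw [← nabla.isCovariantDerivativeOnUniv.add hv hw]
  exact nabla.isCovariantDerivativeOnUniv.congr_of_eventuallyEq
    (mdifferentiableAt_extend ..) (mdifferentiableAt_add_section hv hw) Filter.univ_mem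
    (extend_add v w)

variable {J : Set ℝ} {γ : ℝ → M} {V W : (s : ℝ) → TangentSpace (𝓡 n) (γ s)} {s : ℝ}

/-- `V` is a differentiable vector field along the curve `γ` on `J`. -/
def DiffAlong (J : Set ℝ) (γ : ℝ → M) (V : (s : ℝ) → TangentSpace (𝓡 n) (γ s)) : Prop :=
  ∀ s ∈ J, MDifferentiableWithinAt 𝓘(ℝ, ℝ) (𝓡 n).tangent
    (fun t => (⟨γ t, V t⟩ : TangentBundle (𝓡 n) M)) J s

/-- The components of a field along `γ` in the preferred trivialization at `x`. They are meaningful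
only where `γ` stays in the domain of that trivialization. -/
noncomputable def coords (x : M) (γ : ℝ → M) (V : (s : ℝ) → TangentSpace (𝓡 n) (γ s))
    (t : ℝ) : Rn n :=
  ((trivializationAt (Rn n) (Tan n M) x) ⟨γ t, V t⟩).2

/-- Differentiability along `γ` can be tested at each `s` on the components in the preferred
trivialization at `γ s`, which are those that occur in `covDerivAlong`. -/
lemma diffAlong_iff (hγ : ∀ s ∈ J, MDifferentiableWithinAt 𝓘(ℝ, ℝ) (𝓡 n) γ J s) :
    DiffAlong J γ V ↔ ∀ s ∈ J, DifferentiableWithinAt ℝ (coords (γ s) γ V) J s := by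
  refine forall₂_congr fun s hs => ?_
  erw [mdifferentiableWithinAt_totalSpace]
  rw [← mdifferentiableWithinAt_iff_differentiableWithinAt]
  exact and_iff_right (hγ s hs)

lemma eventually_mem_baseSet (hγ : ContinuousOn γ J) (hs : s ∈ J) :
    ∀ᶠ t in nhdsWithin s J, γ t ∈ (trivializationAt (Rn n) (Tan n M) (γ s)).baseSet :=
  (hγ s hs).preimage_mem_nhdsWithin (baseSet_mem_nhds (γ s))

lemma coords_add {x : M} {t : ℝ} (h : γ t ∈ (trivializationAt (Rn n) (Tan n M) x).baseSet) :
    coords x γ (fun t => V t + W t) t = coords x γ V t + coords x γ W t :=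
  ((trivializationAt (Rn n) (Tan n M) x).linear ℝ h).map_add _ _

lemma coords_smul {x : M} {t : ℝ} (f : ℝ → ℝ)
    (h : γ t ∈ (trivializationAt (Rn n) (Tan n M) x).baseSet) :
    coords x γ (fun t => f t • V t) t = f t • coords x γ V t :=
  ((trivializationAt (Rn n) (Tan n M) x).linear ℝ h).map_smul _ _

lemma covDerivAlong_def (nabla : Connection n M) :
    covDerivAlong nabla J γ V s =
      (trivializationAt (Rn n) (Tan n M) (γ s)).symmL ℝ (γ s)
        (derivWithin (coords (γ s) γ V) J s)
      + nabla (extend (Rn n) (V s)) (γ s) (velocity n J γ s) := by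
  rw [Trivialization.symmL_apply (R := ℝ) _ (FiberBundle.mem_baseSet_trivializationAt' _)]
  rfl

lemma symmL_coords :
    (trivializationAt (Rn n) (Tan n M) (γ s)).symmL ℝ (γ s) (coords (γ s) γ V s) = V s := by
  rw [Trivialization.symmL_apply (R := ℝ) _ (FiberBundle.mem_baseSet_trivializationAt' _)]
  exact extend_apply_self (F := Rn n) (E := Tan n M) (V s)

/-- On `J` the covariant derivative along `γ` depends only on the values of the field on `J`. -/
lemma covDerivAlong_congr (nabla : Connection n M) (h : ∀ t ∈ J, V t = W t) (hs : s ∈ J) :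
    covDerivAlong nabla J γ V s = covDerivAlong nabla J γ W s := by
  have hc : ∀ t ∈ J, coords (γ s) γ V t = coords (γ s) γ W t := fun t ht => by
    simp only [coords, h t ht]
  rw [covDerivAlong_def, covDerivAlong_def, derivWithin_congr hc (hc s hs), h s hs]

variable (hγ : ∀ s ∈ J, MDifferentiableWithinAt 𝓘(ℝ, ℝ) (𝓡 n) γ J s)
include hγ

lemma coords_add_eventuallyEq (hs : s ∈ J) :
    coords (γ s) γ (fun t => V t + W t) =ᶠ[nhdsWithin s J]
      fun t => coords (γ s) γ V t + coords (γ s) γ W t :=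
  (eventually_mem_baseSet (fun s hs => (hγ s hs).continuousWithinAt) hs).mono fun _ h => coords_add h

lemma coords_smul_eventuallyEq (f : ℝ → ℝ) (hs : s ∈ J) :
    coords (γ s) γ (fun t => f t • V t) =ᶠ[nhdsWithin s J]
      fun t => f t • coords (γ s) γ V t :=
  (eventually_mem_baseSet (fun s hs => (hγ s hs).continuousWithinAt) hs).mono fun _ h => coords_smul f h

lemma DiffAlong.add (hV : DiffAlong J γ V) (hW : DiffAlong J γ W) :
    DiffAlong J γ (fun t => V t + W t) := by
  rw [diffAlong_iff hγ] at hV hW ⊢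
  exact fun s hs => ((hV s hs).add (hW s hs)).congr_of_eventuallyEq_of_mem
    (coords_add_eventuallyEq hγ hs) hs

lemma DiffAlong.smul {f : ℝ → ℝ} (hf : DifferentiableOn ℝ f J) (hV : DiffAlong J γ V) :
    DiffAlong J γ (fun t => f t • V t) := by
  rw [diffAlong_iff hγ] at hV ⊢
  exact fun s hs => ((hf s hs).smul (hV s hs)).congr_of_eventuallyEq_of_mem
    (coords_smul_eventuallyEq hγ f hs) hs

lemma coords_zero_eventuallyEq (hs : s ∈ J) :
    coords (n := n) (γ s) γ (fun _ => 0) =ᶠ[nhdsWithin s J] fun _ => 0 :=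
  (eventually_mem_baseSet (fun s hs => (hγ s hs).continuousWithinAt) hs).mono fun _ h =>
    ((trivializationAt (Rn n) (Tan n M) (γ s)).linear ℝ h).map_zero

lemma diffAlong_zero : DiffAlong (n := n) J γ (fun _ => 0) := by
  rw [diffAlong_iff hγ]
  exact fun s hs => (differentiableWithinAt_const 0).congr_of_eventuallyEq_of_mem
    (coords_zero_eventuallyEq hγ hs) hs

lemma covDerivAlong_add (nabla : Connection n M) (hV : DiffAlong J γ V)
    (hW : DiffAlong J γ W) (hs : s ∈ J) :
    covDerivAlong nabla J γ (fun t => V t + W t) s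
      = covDerivAlong nabla J γ V s + covDerivAlong nabla J γ W s := by
  rw [diffAlong_iff hγ] at hV hW
  simp only [covDerivAlong_def]
  rw [(coords_add_eventuallyEq hγ hs).derivWithin_eq_of_mem hs,
    derivWithin_fun_add (hV s hs) (hW s hs), map_add, nabla_extend_add]
  simp only [add_apply]
  abel

/-- The Leibniz rule `∇_{γ'} (f V) = f' V + f ∇_{γ'} V` along a curve. -/
lemma covDerivAlong_smul (nabla : Connection n M) {f : ℝ → ℝ} (hf : DifferentiableOn ℝ f J)
    (hV : DiffAlong J γ V) (hs : s ∈ J) :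
    covDerivAlong nabla J γ (fun t => f t • V t) s
      = derivWithin f J s • V s + f s • covDerivAlong nabla J γ V s := by
  rw [diffAlong_iff hγ] at hV
  simp only [covDerivAlong_def]
  rw [(coords_smul_eventuallyEq hγ f hs).derivWithin_eq_of_mem hs,
    derivWithin_fun_smul (hf s hs) (hV s hs), map_add, map_smul, map_smul, symmL_coords,
    nabla_extend_const_smul, smul_apply, smul_add]
  abel

lemma covDerivAlong_zero (nabla : Connection n M) (hs : s ∈ J) :
    covDerivAlong nabla J γ (fun _ => 0) s = 0 := by
  have h := covDerivAlong_smul hγ nabla (f := fun _ => 0) (differentiableOn_const 0)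
    (diffAlong_zero hγ) hs
  simpa using h

end Along

/-! ### The Lie bracket as a commutator of derivations -/

section Derivation

variable {E : Type*} [NormedAddCommGroup E] [NormedSpace ℝ E]
  {H : Type*} [TopologicalSpace H] {I : ModelWithCorners ℝ E H}
  {M : Type*} [TopologicalSpace M] [ChartedSpace H M] [IsManifold I ∞ M] {x : M}

/-- `σ` is a vector field that is smooth on a neighbourhood of `x`. -/
def SmoothNear (x : M) (σ : (y : M) → TangentSpace I y) : Prop :=
  ∀ᶠ y in nhds x, CMDiffAt ∞ (T% σ) y

variable {σ τ X Y Z : (y : M) → TangentSpace I y}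

lemma SmoothNear.mdifferentiableAt (h : SmoothNear x σ) : MDiffAt (T% σ) x :=
  h.self_of_nhds.mdifferentiableAt (by simp)

lemma SmoothNear.eventually (h : SmoothNear x σ) : ∀ᶠ y in nhds x, SmoothNear y σ :=
  eventually_eventually_nhds.2 h

lemma smoothNear_extend (v : TangentSpace I x) : SmoothNear x (extend E v) := by
  obtain ⟨s, hs, h⟩ := exists_contMDiffOn_extend (k := ∞) I E (V := (TangentSpace I : M → Type _)) v
  filter_upwards [eventually_mem_nhds_iff.2 hs] with y hy using h.contMDiffAt hy

lemma SmoothNear.congr (h : SmoothNear x σ) (hστ : ∀ᶠ y in nhds x, σ y = τ y) :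
    SmoothNear x τ := by
  filter_upwards [h, eventually_eventually_nhds.2 hστ] with y hy hy'
  exact hy.congr_of_eventuallyEq (hy'.mono fun z hz => by simp only [hz])

lemma nabla_congr (nabla : CovariantDerivative I E (TangentSpace I : M → Type _))
    (hσ : SmoothNear x σ) (h : ∀ᶠ y in nhds x, σ y = τ y) : nabla σ x = nabla τ x :=
  nabla.isCovariantDerivativeOnUniv.congr_of_eventuallyEq hσ.mdifferentiableAt
    (hσ.congr h).mdifferentiableAt Filter.univ_mem h

variable [FiniteDimensional ℝ E]

/-- A field that is smooth near `x` agrees near `x` with a globally smooth one, by a cut-off. -/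
lemma exists_global_of_smoothNear [T2Space M] (h : SmoothNear x σ) :
    ∃ τ : (y : M) → TangentSpace I y,
      CMDiff ∞ (T% τ) ∧ ∀ᶠ y in nhds x, τ y = σ y := by
  obtain ⟨u, hu, huo, hxu⟩ := eventually_nhds_iff.1 h
  obtain ⟨f, -, hf⟩ := ((SmoothBumpFunction.nhds_basis_tsupport (I := I) x).mem_iff).1
    (huo.mem_nhds hxu)
  refine ⟨fun y => f y • σ y, ?_, ?_⟩
  · exact ContMDiffOn.smul_section_of_tsupport f.contMDiff.contMDiffOn huo hf
      (fun y hy => (hu y hy).contMDiffWithinAt)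
  · filter_upwards [f.eventuallyEq_one] with y hy
    simp [hy]

/-- The smoothness of a connection is stated for globally smooth fields; it is a local property. -/
lemma SmoothNear.nabla [T2Space M] {nabla : CovariantDerivative I E (TangentSpace I : M → Type _)}
    (hn : CovariantDerivative.ContMDiffCovariantDerivative nabla ∞)
    (hσ : SmoothNear x σ) (hX : SmoothNear x X) : SmoothNear x (fun y => nabla σ y (X y)) := by
  obtain ⟨τ, hτ, hστ⟩ := exists_global_of_smoothNear hσ
  have h1 := hn.contMDiff.contMDiff (σ := τ) hτ.contMDiffOn
  have h2 : SmoothNear x (fun y => nabla τ y (X y)) := by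
    filter_upwards [hX] with y hy
    exact ContMDiffAt.clm_bundle_apply (h1.contMDiffAt Filter.univ_mem) hy
  refine h2.congr ?_
  filter_upwards [hσ.eventually, eventually_eventually_nhds.2 hστ] with y hy hy'
  rw [nabla_congr nabla hy (hy'.mono fun z hz => hz.symm)]

open VectorField

/-- The Lie bracket of vector fields is the commutator of the derivations they define. It follows
by applying the Jacobi identity to `X`, `Y` and `f Z` and comparing coefficients of `Z`, a field
with `Z x ≠ 0`. -/
lemma mvfderiv_mlieBracket {f : M → ℝ} (hX : SmoothNear x X) (hY : SmoothNear x Y)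
    (hZ : SmoothNear x Z) (hZx : Z x ≠ 0) (hf : ∀ᶠ y in nhds x, CMDiffAt ∞ f y)
    (hXf : MDiffAt (fun y => d% f y (X y)) x) (hYf : MDiffAt (fun y => d% f y (Y y)) x) :
    d% f x (mlieBracket I X Y x)
      = d% (fun y => d% f y (Y y)) x (X x) - d% (fun y => d% f y (X y)) x (Y x) := by
  -- Smoothness instances: everything is `C^∞`, hence of each finite order used below.
  have hm : minSmoothness ℝ 2 ≤ ∞ := by
    rw [minSmoothness_of_isRCLikeNormedField]; exact ENat.LEInfty.out
  have : IsManifold I (minSmoothness ℝ 3) M := IsManifold.of_le (n := ∞) (by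
    rw [minSmoothness_of_isRCLikeNormedField]; exact ENat.LEInfty.out)
  have : IsManifold I (minSmoothness ℝ 2) M := IsManifold.of_le hm
  have : IsManifold I (((2 : ℕ∞) : WithTop ℕ∞) + 1) M :=
    IsManifold.of_le (n := ∞) (by exact_mod_cast le_top)
  have le : ∀ {V : (y : M) → TangentSpace I y}, SmoothNear x V →
      CMDiffAt (minSmoothness ℝ 2) (T% V) x := fun h => h.self_of_nhds.of_le hm
  have hfx : MDiffAt f x := hf.self_of_nhds.mdifferentiableAt (by simp)
  have hfZ : SmoothNear x (f • Z) := by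
    filter_upwards [hf, hZ] with y h1 h2 using h1.smul_section h2
  -- The expansion of `[A, [B, f Z]]`; the terms that are not symmetric in `A` and `B` survive below.
  have key : ∀ {A B : (y : M) → TangentSpace I y}, SmoothNear x A → SmoothNear x B →
      MDiffAt (fun y => d% f y (B y)) x →
      mlieBracket I A (mlieBracket I B (f • Z)) x
        = d% (fun y => d% f y (B y)) x (A x) • Z x
          + d% f x (B x) • mlieBracket I A Z x
          + d% f x (A x) • mlieBracket I B Z x
          + f x • mlieBracket I A (mlieBracket I B Z) x := by
    intro A B hA hB hBf
    have hBZ : MDiffAt (T% (mlieBracket I B Z)) x :=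
      (ContMDiffAt.mlieBracket_vectorField (m := 1) (n := 2) (hB.self_of_nhds.of_le ENat.LEInfty.out)
        (hZ.self_of_nhds.of_le ENat.LEInfty.out) (by simp; norm_cast)).mdifferentiableAt (by simp)
    have h : mlieBracket I B (f • Z) =ᶠ[nhds x]
        (fun y => d% f y (B y)) • Z + f • mlieBracket I B Z := by
      filter_upwards [hf, hZ] with y h1 h2
      exact mlieBracket_smul_right (h1.mdifferentiableAt (by simp)) (h2.mdifferentiableAt (by simp))
    rw [Filter.EventuallyEq.mlieBracket_vectorField_eq (I := I) (V := A) Filter.EventuallyEq.rfl h,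
      mlieBracket_add_right (hBf.smul_section hZ.mdifferentiableAt) (hfx.smul_section hBZ),
      mlieBracket_smul_right hBf hZ.mdifferentiableAt, mlieBracket_smul_right hfx hBZ]
    simp only [add_assoc]
  have J1 := leibniz_identity_mlieBracket_apply (le hX) (le hY) (le hfZ)
  have J2 := leibniz_identity_mlieBracket_apply (le hX) (le hY) (le hZ)
  rw [key hX hY hYf, key hY hX hXf, mlieBracket_smul_right hfx hZ.mdifferentiableAt, J2] at J1
  have : (d% f x (mlieBracket I X Y x)
      - (d% (fun y => d% f y (Y y)) x (X x) - d% (fun y => d% f y (X y)) x (Y x))) • Z x = 0 := by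
    rw [sub_smul, sub_smul]
    linear_combination (norm := module) -J1
  exact sub_eq_zero.1 ((smul_eq_zero.1 this).resolve_right hZx)

end Derivation

/-! ### The curvature tensor -/

section Curvature

open VectorField

variable {n : ℕ} {M : Type*} [TopologicalSpace M] [ChartedSpace (Rn n) M]
  [IsManifold (𝓡 n) ∞ M]

/-- Homogeneity of `R(u, v) w` in `v`, the only instance of tensoriality that is needed. -/
lemma curvature_smul_mid [T2Space M] {nabla : Connection n M}
    (hn : CovariantDerivative.ContMDiffCovariantDerivative nabla ∞)
    {x : M} (c : ℝ) (u v w : TangentSpace (𝓡 n) x) :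
    curvature nabla x u (c • v) w = c • curvature nabla x u v w := by
  have hX := smoothNear_extend u
  have hY := smoothNear_extend v
  have hY' := smoothNear_extend (c • v)
  have hZ := smoothNear_extend w
  have he := extend_const_smul (n := n) c v
  simp only [curvature, extend_apply_self]
  have h1 : nabla (fun y => nabla (extend (Rn n) w) y (extend (Rn n) (c • v) y)) x
      = c • nabla (fun y => nabla (extend (Rn n) w) y (extend (Rn n) v y)) x := by
    have hs := SmoothNear.nabla hn hZ hY
    rw [← nabla.isCovariantDerivativeOnUniv.smul_const c hs.mdifferentiableAt]
    refine nabla_congr nabla (SmoothNear.nabla hn hZ hY') (he.mono fun y hy => ?_)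
    simp only [hy, Pi.smul_apply, map_smul]
  have h2 : mlieBracket (𝓡 n) (extend (Rn n) u) (extend (Rn n) (c • v)) x
      = c • mlieBracket (𝓡 n) (extend (Rn n) u) (extend (Rn n) v) x := by
    rw [← mlieBracket_const_smul_right hY.mdifferentiableAt]
    exact Filter.EventuallyEq.mlieBracket_vectorField_eq Filter.EventuallyEq.rfl he
  rw [h1, h2]
  simp only [map_smul, smul_apply, smul_sub]

variable [RiemannianBundle (Tan n M)]
    [IsContMDiffRiemannianBundle (𝓡 n) ∞ (Rn n) (Tan n M)]

lemma SmoothNear.inner {x : M} {σ τ : (y : M) → TangentSpace (𝓡 n) y} (hσ : SmoothNear x σ)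
    (hτ : SmoothNear x τ) :
    ∀ᶠ y in nhds x, ContMDiffAt (𝓡 n) 𝓘(ℝ, ℝ) ∞ (fun y => inner ℝ (σ y) (τ y)) y := by
  filter_upwards [hσ, hτ] with y h1 h2
  exact ContMDiffAt.inner_bundle (F := Rn n) (E := Tan n M) h1 h2

set_option synthInstance.maxHeartbeats 400000 in
/-- The curvature operator `R(u, v)` of the Levi-Civita connection is skew-adjoint: with the
extensions `X`, `Y`, `Z`, `W` of `u`, `v`, `w`, `z`, expand both sides of
`[X, Y] ⟨Z, W⟩ = X (Y ⟨Z, W⟩) - Y (X ⟨Z, W⟩)` by compatibility with the metric. -/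
lemma inner_curvature_skew [T2Space M] {nabla : Connection n M} (hn : IsLeviCivita nabla)
    {x : M} (u v w z : TangentSpace (𝓡 n) x) :
    inner ℝ (curvature nabla x u v w) z = - inner ℝ (curvature nabla x u v z) w := by
  by_cases ha : ∃ a : TangentSpace (𝓡 n) x, a ≠ 0
  swap
  -- In a zero tangent space there is nothing to prove.
  · push Not at ha
    simp only [ha, inner_zero_right, neg_zero]
  obtain ⟨a, ha⟩ := ha
  have hX := smoothNear_extend u
  have hY := smoothNear_extend v
  have hZ := smoothNear_extend w
  have hW := smoothNear_extend z
  set X : (y : M) → TangentSpace (𝓡 n) y := extend (Rn n) u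
  set Y : (y : M) → TangentSpace (𝓡 n) y := extend (Rn n) v
  set Z : (y : M) → TangentSpace (𝓡 n) y := extend (Rn n) w
  set W : (y : M) → TangentSpace (𝓡 n) y := extend (Rn n) z
  have metric : ∀ {A B C : (y : M) → TangentSpace (𝓡 n) y} {y : M}, SmoothNear y B →
      SmoothNear y C → mvfderiv (𝓡 n) (fun y => inner ℝ (B y) (C y)) y (A y)
        = inner ℝ (nabla B y (A y)) (C y) + inner ℝ (B y) (nabla C y (A y)) :=
    fun {A _ _ _} hB hC => hn.metric.mvfderiv_inner_eq A hB.mdifferentiableAt hC.mdifferentiableAt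
  have hsm : ∀ {A B : (y : M) → TangentSpace (𝓡 n) y}, SmoothNear x A → SmoothNear x B →
      SmoothNear x (fun y => nabla A y (B y)) := fun hA hB => SmoothNear.nabla hn.smooth hA hB
  have hf := hZ.inner hW
  have hD : ∀ {A : (y : M) → TangentSpace (𝓡 n) y}, SmoothNear x A →
      (fun y => mvfderiv (𝓡 n) (fun y => inner ℝ (Z y) (W y)) y (A y)) =ᶠ[nhds x]
      (fun y => inner ℝ (nabla Z y (A y)) (W y)) + (fun y => inner ℝ (Z y) (nabla W y (A y))) := by
    intro A hA
    filter_upwards [hZ.eventually, hW.eventually] with y h1 h2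
    exact metric h1 h2
  have hd1 : ∀ {A : (y : M) → TangentSpace (𝓡 n) y}, SmoothNear x A →
      MDifferentiableAt (𝓡 n) 𝓘(ℝ, ℝ) (fun y => inner ℝ (nabla Z y (A y)) (W y)) x :=
    fun hA => ((hsm hZ hA).inner hW).self_of_nhds.mdifferentiableAt (by simp)
  have hd2 : ∀ {A : (y : M) → TangentSpace (𝓡 n) y}, SmoothNear x A →
      MDifferentiableAt (𝓡 n) 𝓘(ℝ, ℝ) (fun y => inner ℝ (Z y) (nabla W y (A y))) x :=
    fun hA => (hZ.inner (hsm hW hA)).self_of_nhds.mdifferentiableAt (by simp)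
  have hdf : ∀ {A : (y : M) → TangentSpace (𝓡 n) y}, SmoothNear x A →
      MDifferentiableAt (𝓡 n) 𝓘(ℝ, ℝ)
        (fun y => mvfderiv (𝓡 n) (fun y => inner ℝ (Z y) (W y)) y (A y)) x :=
    fun hA => ((hd1 hA).add (hd2 hA)).congr_of_eventuallyEq (hD hA)
  have hDD : ∀ {A B : (y : M) → TangentSpace (𝓡 n) y}, SmoothNear x A → SmoothNear x B →
      mvfderiv (𝓡 n) (fun y => mvfderiv (𝓡 n) (fun y => inner ℝ (Z y) (W y)) y (A y)) x (B x)
      = inner ℝ (nabla (fun y => nabla Z y (A y)) x (B x)) (W x)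
        + inner ℝ (nabla Z x (A x)) (nabla W x (B x))
        + (inner ℝ (nabla Z x (B x)) (nabla W x (A x))
        + inner ℝ (Z x) (nabla (fun y => nabla W y (A y)) x (B x))) := by
    intro A B hA hB
    have h := (hD hA).mfderiv_eq (I := 𝓡 n) (I' := 𝓘(ℝ, ℝ))
    have h' : mvfderiv (𝓡 n) (fun y => mvfderiv (𝓡 n) (fun y => inner ℝ (Z y) (W y)) y (A y)) x
      = mvfderiv (𝓡 n) ((fun y => inner ℝ (nabla Z y (A y)) (W y))
        + (fun y => inner ℝ (Z y) (nabla W y (A y)))) x := ContinuousLinearMap.ext fun v => DFunLike.congr_fun h v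
    rw [h', mvfderiv_add (hd1 hA) (hd2 hA), add_apply, metric (hsm hZ hA) hW,
      metric hZ (hsm hW hA)]
  have hax : extend (Rn n) a x ≠ 0 := by simpa using ha
  have hbr := mvfderiv_mlieBracket hX hY (smoothNear_extend a) hax hf (hdf hX) (hdf hY)
  rw [hDD hX hY, hDD hY hX, metric hZ hW] at hbr
  have hZ' : Z x = w := extend_apply_self _ _
  have hW' : W x = z := extend_apply_self _ _
  have e1 : curvature nabla x u v w = nabla (fun y => nabla Z y (Y y)) x (X x)
    - nabla (fun y => nabla Z y (X y)) x (Y x) - nabla Z x (mlieBracket (𝓡 n) X Y x) := rfl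
  have e2 : curvature nabla x u v z = nabla (fun y => nabla W y (Y y)) x (X x)
    - nabla (fun y => nabla W y (X y)) x (Y x) - nabla W x (mlieBracket (𝓡 n) X Y x) := rfl
  rw [e1, e2, ← hZ', ← hW']
  simp only [inner_sub_left, inner_sub_right, real_inner_comm (Z x)] at hbr ⊢
  linarith

end Curvature

/-! ### Computations in a Frenet frame -/

section Frenet

variable {n : ℕ} {M : Type*} [TopologicalSpace M] [ChartedSpace (Rn n) M]
  [IsManifold (𝓡 n) ∞ M] [RiemannianBundle (Tan n M)]
  {nabla : Connection n M} {J : Set ℝ} {γ : ℝ → M}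
  {F : ℕ → (s : ℝ) → TangentSpace (𝓡 n) (γ s)} {k : ℕ → ℝ → ℝ}
  {s : ℝ}

lemma uniqueDiffOn_of_ordConnected (hJ : J.OrdConnected) (hJ' : J.Nontrivial) :
    UniqueDiffOn ℝ J :=
  uniqueDiffOn_convex hJ.convex (hJ.convex.nontrivial_iff_nonempty_interior.1 hJ')

omit [IsManifold (𝓡 n) ∞ M] in
lemma IsUnitSpeed.mdifferentiableWithinAt (h : IsUnitSpeed n J γ) :
    ∀ s ∈ J, MDifferentiableWithinAt 𝓘(ℝ, ℝ) (𝓡 n) γ J s :=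
  fun s hs => (h.1 s hs).mdifferentiableWithinAt (by simp)

namespace IsFrenetFrame

variable (hF : IsFrenetFrame nabla J γ F k)
include hF

lemma contDiffOn_curvature (i : ℕ) : ContDiffOn ℝ ∞ (k i) J := by
  by_cases h : 1 ≤ i ∧ i < n
  · exact hF.smooth_curvature i h.1 h.2
  · have : k i = fun _ => 0 := funext fun s => hF.curvature_eq_zero i s (by omega)
    rw [this]
    exact contDiffOn_const

lemma diffAlong (hγ : IsUnitSpeed n J γ) (i : ℕ) : DiffAlong J γ (F i) := by
  by_cases h : 1 ≤ i ∧ i ≤ n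
  · exact fun s hs => (hF.smooth_frame i h.1 h.2 s hs).mdifferentiableWithinAt (by simp)
  · have : F i = fun _ => 0 := funext fun s => hF.frame_eq_zero i s (by omega)
    rw [this]
    exact diffAlong_zero hγ.mdifferentiableWithinAt

/-- The Frenet equations in one formula: the conventions `F i = 0` and `k i = 0` outside the proper
range make it hold for every `i ≥ 1`. -/
lemma covDerivAlong_frame (hγ : IsUnitSpeed n J γ) {i : ℕ} (hi : 1 ≤ i) (hs : s ∈ J) :
    covDerivAlong nabla J γ (F i) s
      = -(k (i - 1) s) • F (i - 1) s + k i s • F (i + 1) s := by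
  rcases lt_or_ge n i with h | h
  · have h0 : F i = fun _ => 0 := funext fun s => hF.frame_eq_zero i s (Or.inr h)
    rw [h0, covDerivAlong_zero hγ.mdifferentiableWithinAt nabla hs,
      hF.curvature_eq_zero (i - 1) s (by omega), hF.curvature_eq_zero i s (by omega)]
    simp
  · rcases hi.eq_or_lt with rfl | hi
    · rw [hF.deriv_one s hs, hF.curvature_eq_zero (1 - 1) s (by simp)]
      simp
    · exact hF.deriv s hs i hi h

lemma inner_frame {i j : ℕ} (hs : s ∈ J) (hi : 1 ≤ i) (hj : 1 ≤ j) (hjn : j ≤ n) :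
    inner ℝ (F i s) (F j s) = if i = j then (1 : ℝ) else 0 := by
  rcases lt_or_ge n i with h | h
  · rw [hF.frame_eq_zero i s (Or.inr h), inner_zero_left, if_neg (by omega)]
  · exact hF.orthonormal s hs i j hi h hj hjn

lemma norm_frame (hs : s ∈ J) {i : ℕ} (hi : 1 ≤ i) (hin : i ≤ n) : ‖F i s‖ = 1 := by
  have h := hF.inner_frame hs hi hi hin
  rw [if_pos rfl, real_inner_self_eq_norm_sq] at h
  exact (pow_eq_one_iff_of_nonneg (norm_nonneg _) two_ne_zero).1 h

/-- The frame is a basis of the tangent space, so a vector vanishes if its components do. -/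
lemma eq_zero_iff (hn : 2 ≤ n) (hs : s ∈ J) (v : TangentSpace (𝓡 n) (γ s)) :
    v = 0 ↔ ∀ j, 1 ≤ j → j ≤ n → inner ℝ v (F j s) = 0 := by
  refine ⟨fun h j _ _ => by rw [h, inner_zero_left], fun h => ?_⟩
  have ho : Orthonormal ℝ (fun j : Fin n => F (j + 1) s) := by
    rw [orthonormal_iff_ite]
    intro i j
    rw [hF.inner_frame hs (by omega) (by omega) (by omega)]
    simp [Fin.ext_iff]
  have : Nonempty (Fin n) := ⟨⟨0, by omega⟩⟩
  have hcard : Fintype.card (Fin n) = Module.finrank ℝ (TangentSpace (𝓡 n) (γ s)) := by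
    change _ = Module.finrank ℝ (Rn n)
    simp
  have hb := coe_basisOfLinearIndependentOfCardEqFinrank ho.linearIndependent hcard
  refine InnerProductSpace.ext_inner_right_basis (𝕜 := ℝ)
    (basisOfLinearIndependentOfCardEqFinrank ho.linearIndependent hcard) fun i => ?_
  rw [hb, inner_zero_left]
  exact h _ (by omega) (by omega)

lemma tension_eq (hs : s ∈ J) : tension nabla J γ s = k 1 s • F 2 s := by
  rw [← hF.deriv_one s hs]
  exact covDerivAlong_congr nabla (fun t ht => (hF.frame_one t ht).symm) hs

/-- The second covariant derivative of `a F₂`. -/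
lemma covDerivAlong_covDerivAlong_smul_frame_two (hγ : IsUnitSpeed n J γ) {a : ℝ → ℝ}
    (hJ : UniqueDiffOn ℝ J) (ha : ContDiffOn ℝ ∞ a J) (hs : s ∈ J) :
    covDerivAlong nabla J γ (covDerivAlong nabla J γ (fun t => a t • F 2 t)) s
      = (-2 * derivWithin a J s * k 1 s - a s * derivWithin (k 1) J s) • F 1 s
        + (derivWithin (derivWithin a J) J s - a s * k 1 s ^ 2 - a s * k 2 s ^ 2) • F 2 s
        + (2 * derivWithin a J s * k 2 s + a s * derivWithin (k 2) J s) • F 3 s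
        + (a s * k 2 s * k 3 s) • F 4 s := by
  have hm := hγ.mdifferentiableWithinAt
  have hd {f : ℝ → ℝ} (hf : ContDiffOn ℝ ∞ f J) : DifferentiableOn ℝ f J :=
    hf.differentiableOn (by simp)
  have ha' : ContDiffOn ℝ ∞ (derivWithin a J) J := ha.derivWithin hJ (by simp)
  have hk := hF.contDiffOn_curvature
  have hD := hF.diffAlong hγ
  have hak (i : ℕ) : ContDiffOn ℝ ∞ (fun t => a t * k i t) J := ha.mul (hk i)
  have h1 : ∀ t ∈ J, covDerivAlong nabla J γ (fun t => a t • F 2 t) t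
      = (derivWithin a J t • F 2 t + (-(a t * k 1 t)) • F 1 t) + (a t * k 2 t) • F 3 t := by
    intro t ht
    rw [covDerivAlong_smul hm nabla (hd ha) (hD 2) ht, hF.covDerivAlong_frame hγ one_le_two ht]
    module
  have hder (i : ℕ) : derivWithin (fun t => a t * k i t) J s
      = derivWithin a J s * k i s + a s * derivWithin (k i) J s :=
    derivWithin_fun_mul (hd ha s hs) (hd (hk i) s hs)
  rw [covDerivAlong_congr nabla h1 hs,
    covDerivAlong_add hm nabla
      (((hD 2).smul hm (hd ha')).add hm ((hD 1).smul hm (hd (hak 1).neg)))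
      ((hD 3).smul hm (hd (hak 2))) hs,
    covDerivAlong_add hm nabla ((hD 2).smul hm (hd ha')) ((hD 1).smul hm (hd (hak 1).neg)) hs,
    covDerivAlong_smul hm nabla (hd ha') (hD 2) hs,
    covDerivAlong_smul hm nabla (hd (hak 1).neg) (hD 1) hs,
    covDerivAlong_smul hm nabla (hd (hak 2)) (hD 3) hs,
    hF.covDerivAlong_frame hγ le_rfl hs, hF.covDerivAlong_frame hγ one_le_two hs,
    hF.covDerivAlong_frame hγ (by simp) hs, derivWithin.fun_neg, hder 1, hder 2,
    hF.curvature_eq_zero (1 - 1) s (by simp)]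
  norm_num only
  module

lemma norm_rpow_smul_tension (hn : 2 ≤ n) (hk : ∀ s ∈ J, 0 < k 1 s) (p : ℝ) (hs : s ∈ J) :
    ‖tension nabla J γ s‖ ^ (p - 2) • tension nabla J γ s = k 1 s ^ (p - 1) • F 2 s := by
  rw [hF.tension_eq hs, norm_smul, hF.norm_frame hs one_le_two hn, mul_one, Real.norm_eq_abs,
    abs_of_pos (hk s hs), smul_smul, ← Real.rpow_add_one (hk s hs).ne']
  ring_nf

lemma derivWithin_rpow (hJ : UniqueDiffOn ℝ J) (hk : ∀ s ∈ J, 0 < k 1 s) (q : ℝ) (hs : s ∈ J) :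
    derivWithin (fun t => k 1 t ^ q) J s = q * k 1 s ^ (q - 1) * derivWithin (k 1) J s := by
  have h := ((hF.contDiffOn_curvature 1).differentiableOn (by simp) s hs).hasDerivWithinAt
  rw [(h.rpow_const (Or.inl (hk s hs).ne')).derivWithin (hJ s hs)]
  ring

lemma derivWithin_derivWithin_rpow (hJ : UniqueDiffOn ℝ J) (hk : ∀ s ∈ J, 0 < k 1 s) (q : ℝ)
    (hs : s ∈ J) :
    derivWithin (derivWithin (fun t => k 1 t ^ q) J) J s
      = q * (q - 1) * k 1 s ^ (q - 2) * derivWithin (k 1) J s ^ 2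
        + q * k 1 s ^ (q - 1) * derivWithin (derivWithin (k 1) J) J s := by
  have hk1 := hF.contDiffOn_curvature 1
  have hk1' : ContDiffOn ℝ ∞ (derivWithin (k 1) J) J := hk1.derivWithin hJ (by simp)
  have hd := (hk1.differentiableOn (by simp) s hs).hasDerivWithinAt
  have hd' := (hk1'.differentiableOn (by simp) s hs).hasDerivWithinAt
  have h := ((hd.rpow_const (p := q - 1) (Or.inl (hk s hs).ne')).const_mul q).mul hd'
  have he : ∀ t ∈ J, derivWithin (fun t => k 1 t ^ q) J t
      = ((fun t => q * k 1 t ^ (q - 1)) * derivWithin (k 1) J) t :=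
    fun t ht => hF.derivWithin_rpow hJ hk q ht
  rw [derivWithin_congr he (he s hs), h.derivWithin (hJ s hs)]
  ring_nf

lemma isPBiharmonic_iff (hn : 2 ≤ n) {p : ℝ} : IsPBiharmonic nabla p J γ ↔
    ∀ s ∈ J, ∀ j, 1 ≤ j → j ≤ n → inner ℝ (eulerLagrange nabla p J γ s) (F j s) = 0 :=
  forall₂_congr fun _ hs => hF.eq_zero_iff hn hs _

lemma isPElastic_iff (hn : 2 ≤ n) {p : ℝ} : IsPElastic nabla p J γ ↔
    ∀ s ∈ J, ∀ j, 2 ≤ j → j ≤ n → inner ℝ (eulerLagrange nabla p J γ s) (F j s) = 0 := by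
  refine forall₂_congr fun s hs => ?_
  rw [hF.eq_zero_iff hn hs, ← hF.frame_one s hs]
  simp only [inner_sub_left, real_inner_smul_left]
  constructor
  · intro h j hj hjn
    have := h j (by omega) hjn
    rwa [hF.inner_frame hs le_rfl (by omega) hjn, if_neg (by omega), mul_zero, sub_zero] at this
  · intro h j hj hjn
    rw [hF.inner_frame hs le_rfl hj hjn]
    rcases hj.eq_or_lt with rfl | hj
    · simp
    · rw [h j hj hjn, if_neg (by omega), mul_zero, sub_zero]

end IsFrenetFrame

end Frenet

/-! ### The Euler-Lagrange equations in the Frenet frame -/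

section System

variable {n : ℕ} {M : Type*} [TopologicalSpace M] [T2Space M] [ChartedSpace (Rn n) M]
  [IsManifold (𝓡 n) ∞ M] [RiemannianBundle (Tan n M)]
  [IsContMDiffRiemannianBundle (𝓡 n) ∞ (Rn n) (Tan n M)]
  {nabla : Connection n M} {J : Set ℝ} {γ : ℝ → M}
  {F : ℕ → (s : ℝ) → TangentSpace (𝓡 n) (γ s)} {k : ℕ → ℝ → ℝ} {p s : ℝ}

namespace IsFrenetFrame

/-- The Euler-Lagrange expression in the Frenet frame. -/
lemma eulerLagrange_eq (hF : IsFrenetFrame nabla J γ F k) (hn : 2 ≤ n) (hL : IsLeviCivita nabla)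
    (hJ : UniqueDiffOn ℝ J) (hγ : IsUnitSpeed n J γ) (hk : ∀ s ∈ J, 0 < k 1 s) (hs : s ∈ J) :
    eulerLagrange nabla p J γ s
      = ((1 - 2 * p) * k 1 s ^ (p - 1) * derivWithin (k 1) J s) • F 1 s
        + ((p - 1) * (p - 2) * k 1 s ^ (p - 3) * derivWithin (k 1) J s ^ 2
          + (p - 1) * k 1 s ^ (p - 2) * derivWithin (derivWithin (k 1) J) J s
          - k 1 s ^ (p + 1) - k 1 s ^ (p - 1) * k 2 s ^ 2) • F 2 s
        + (2 * (p - 1) * k 1 s ^ (p - 2) * derivWithin (k 1) J s * k 2 s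
          + k 1 s ^ (p - 1) * derivWithin (k 2) J s) • F 3 s
        + (k 1 s ^ (p - 1) * k 2 s * k 3 s) • F 4 s
        - k 1 s ^ (p - 1) • curvature nabla (γ s) (F 1 s) (F 2 s) (F 1 s) := by
  have hp := hk s hs
  have ha : ContDiffOn ℝ ∞ (fun t => k 1 t ^ (p - 1)) J :=
    (hF.contDiffOn_curvature 1).rpow_const_of_ne fun t ht => (hk t ht).ne'
  have h1 : ∀ t ∈ J, covDerivAlong nabla J γ
      (fun t => ‖tension nabla J γ t‖ ^ (p - 2) • tension nabla J γ t) t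
      = covDerivAlong nabla J γ (fun t => k 1 t ^ (p - 1) • F 2 t) t := fun t ht =>
    covDerivAlong_congr nabla (fun u hu => hF.norm_rpow_smul_tension hn hk p hu) ht
  have h2 : ‖tension nabla J γ s‖ ^ (p - 2) •
      curvature nabla (γ s) (velocity n J γ s) (tension nabla J γ s) (velocity n J γ s)
      = k 1 s ^ (p - 1) • curvature nabla (γ s) (F 1 s) (F 2 s) (F 1 s) := by
    rw [hF.tension_eq hs, ← hF.frame_one s hs, curvature_smul_mid hL.smooth, smul_smul, norm_smul,
      hF.norm_frame hs one_le_two hn, mul_one, Real.norm_eq_abs, abs_of_pos hp,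
      ← Real.rpow_add_one hp.ne']
    ring_nf
  have e1 : k 1 s ^ (p - 1) = k 1 s ^ (p - 2) * k 1 s := by
    rw [← Real.rpow_add_one hp.ne']; ring_nf
  have e2 : k 1 s ^ (p + 1) = k 1 s ^ (p - 1) * k 1 s ^ 2 := by
    rw [← Real.rpow_add_natCast hp.ne']; ring_nf
  rw [eulerLagrange, covDerivAlong_congr nabla h1 hs, h2,
    hF.covDerivAlong_covDerivAlong_smul_frame_two hγ hJ ha hs, hF.derivWithin_rpow hJ hk _ hs,
    hF.derivWithin_derivWithin_rpow hJ hk _ hs, e2, show p - 1 - 2 = p - 3 by ring,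
    show p - 1 - 1 = p - 2 by ring]
  congr 5
  · rw [e1]; ring
  · ring

end IsFrenetFrame

variable (hF : IsFrenetFrame nabla J γ F k) (hn : 2 ≤ n) (hL : IsLeviCivita nabla)
    (hJ : UniqueDiffOn ℝ J) (hγ : IsUnitSpeed n J γ) (hk : ∀ s ∈ J, 0 < k 1 s)
include hF hn hL hJ hγ hk

namespace IsFrenetFrame

lemma inner_eulerLagrange_frame (hs : s ∈ J) {j : ℕ} (hj : 1 ≤ j) (hjn : j ≤ n) :
    inner ℝ (eulerLagrange nabla p J γ s) (F j s)
      = (if 1 = j then (1 - 2 * p) * k 1 s ^ (p - 1) * derivWithin (k 1) J s else 0)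
        + (if 2 = j then (p - 1) * (p - 2) * k 1 s ^ (p - 3) * derivWithin (k 1) J s ^ 2
          + (p - 1) * k 1 s ^ (p - 2) * derivWithin (derivWithin (k 1) J) J s
          - k 1 s ^ (p + 1) - k 1 s ^ (p - 1) * k 2 s ^ 2 else 0)
        + (if 3 = j then 2 * (p - 1) * k 1 s ^ (p - 2) * derivWithin (k 1) J s * k 2 s
          + k 1 s ^ (p - 1) * derivWithin (k 2) J s else 0)
        + (if 4 = j then k 1 s ^ (p - 1) * k 2 s * k 3 s else 0)
        - k 1 s ^ (p - 1) * curvatureComponent nabla γ F 1 2 1 j s := by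
  rw [hF.eulerLagrange_eq hn hL hJ hγ hk hs, inner_sub_left, inner_add_left, inner_add_left,
    inner_add_left]
  simp only [real_inner_smul_left]
  rw [hF.inner_frame hs le_rfl hj hjn, hF.inner_frame hs one_le_two hj hjn,
    hF.inner_frame hs (by simp) hj hjn, hF.inner_frame hs (by simp) hj hjn, curvatureComponent]
  simp only [mul_ite, mul_one, mul_zero]

/-- The tangential component involves no curvature term, because `R(F₁, F₂)` is skew-adjoint. -/
lemma inner_eulerLagrange_frame_one (hs : s ∈ J) :
    inner ℝ (eulerLagrange nabla p J γ s) (F 1 s)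
      = (1 - 2 * p) * k 1 s ^ (p - 1) * derivWithin (k 1) J s := by
  rw [hF.inner_eulerLagrange_frame hn hL hJ hγ hk hs le_rfl (by omega)]
  have h : curvatureComponent nabla γ F 1 2 1 1 s = 0 := by
    have := inner_curvature_skew hL (F 1 s) (F 2 s) (F 1 s) (F 1 s)
    unfold curvatureComponent
    linarith
  simp [h]

/-- The elastic system collects the components of the Euler-Lagrange expression along
`F₂, …, F_n`. For `n = 2` and `n = 3` its equations for `F₃` and `F₄` are trivial. -/
lemma pElasticSystem_iff : PElasticSystem nabla p J γ F k ↔ ∀ s ∈ J, ∀ j, 2 ≤ j → j ≤ n →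
    inner ℝ (eulerLagrange nabla p J γ s) (F j s) = 0 := by
  have hI : ∀ s ∈ J, ∀ j, 2 ≤ j → j ≤ n → _ := fun s hs j hj hjn =>
    hF.inner_eulerLagrange_frame (p := p) hn hL hJ hγ hk hs (j := j) (by omega) hjn
  have hskew : ∀ s, curvatureComponent nabla γ F 1 2 1 2 s
      = - curvatureComponent nabla γ F 1 2 2 1 s := fun s => inner_curvature_skew hL ..
  have hzero : ∀ j, n < j → ∀ s, curvatureComponent nabla γ F 1 2 1 j s = 0 := by
    intro j hj s
    rw [curvatureComponent, hF.frame_eq_zero j s (Or.inr hj), inner_zero_right]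
  constructor
  · intro h s hs j hj hjn
    rw [hI s hs j hj hjn]
    obtain rfl | rfl | rfl | hj : j = 2 ∨ j = 3 ∨ j = 4 ∨ 5 ≤ j := by omega
    · have := h.eq_two s hs
      simp [hskew]
      linarith
    · have := h.eq_three s hs
      simp
      linarith
    · have := h.eq_four s hs
      simp
      linarith
    · have := h.eq_rest s hs j hj hjn
      rw [if_neg (by omega), if_neg (by omega), if_neg (by omega), if_neg (by omega)]
      linarith
  · intro h
    have hI' := fun s hs j hj hjn => (hI s hs j hj hjn).symm.trans (h s hs j hj hjn)
    refine ⟨fun s hs => ?_, fun s hs => ?_, fun s hs => ?_, fun s hs j hj hjn => ?_⟩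
    · have := hI' s hs 2 le_rfl hn
      simp [hskew] at this
      linarith
    · rcases lt_or_ge n 3 with h3 | h3
      · have h2 : k 2 = fun _ => 0 := funext fun t => hF.curvature_eq_zero 2 t (by omega)
        simp [hzero 3 h3, h2]
      · have := hI' s hs 3 (by simp) h3
        simp at this
        linarith
    · rcases lt_or_ge n 4 with h4 | h4
      · simp [hzero 4 h4, hF.curvature_eq_zero 3 s (by omega)]
      · have := hI' s hs 4 (by simp) h4
        simp at this
        linarith
    · have := hI' s hs j (by omega) hjn
      rw [if_neg (by omega), if_neg (by omega), if_neg (by omega), if_neg (by omega)] at this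
      linarith

end IsFrenetFrame

theorem isPElastic_iff_pElasticSystem :
    IsPElastic nabla p J γ ↔ PElasticSystem nabla p J γ F k := by
  rw [hF.isPElastic_iff hn, hF.pElasticSystem_iff hn hL hJ hγ hk]

theorem isPBiharmonic_iff_pBiharmonicSystem :
    IsPBiharmonic nabla p J γ ↔ PBiharmonicSystem nabla p J γ F k := by
  rw [PBiharmonicSystem, hF.isPBiharmonic_iff hn, hF.pElasticSystem_iff hn hL hJ hγ hk,
    TangentialEquation]
  constructor
  · intro h
    exact ⟨fun s hs => by
      rw [← hF.inner_eulerLagrange_frame_one hn hL hJ hγ hk hs, h s hs 1 le_rfl (by omega)],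
      fun s hs j hj hjn => h s hs j (by omega) hjn⟩
  · rintro ⟨h1, h2⟩ s hs j hj hjn
    rcases hj.eq_or_lt with rfl | hj
    · rw [hF.inner_eulerLagrange_frame_one hn hL hJ hγ hk hs, ← h1 s hs]
    · exact h2 s hs j hj hjn

end System

/-! ### Comparison of the systems of equations -/

section Algebra

variable {n : ℕ} {M : Type*} [TopologicalSpace M] [ChartedSpace (Rn n) M]
  [IsManifold (𝓡 n) ∞ M] [RiemannianBundle (Tan n M)]
  {nabla : Connection n M} {J : Set ℝ} {γ : ℝ → M}
  {F : ℕ → (s : ℝ) → TangentSpace (𝓡 n) (γ s)} {k : ℕ → ℝ → ℝ} {p s : ℝ}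

/-- For `p ≠ 1/2` the tangential equation forces `k₁` to be constant, and the powers of `k₁` cancel
from the remaining equations. -/
theorem pBiharmonicSystem_iff_properBiharmonicSystem
    (hF : IsFrenetFrame nabla J γ F k) (hJo : J.OrdConnected) (hJ : J.Nontrivial)
    (hk : ∀ s ∈ J, 0 < k 1 s) (hp : p ≠ 1 / 2) :
    PBiharmonicSystem nabla p J γ F k ↔ ProperBiharmonicSystem nabla J γ F k := by
  have hU := uniqueDiffOn_of_ordConnected hJo hJ
  have hpow : ∀ s ∈ J, k 1 s ^ (p - 1) ≠ 0 := fun s hs => (Real.rpow_pos_of_pos (hk s hs) _).ne'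
  have e2 : ∀ s ∈ J, k 1 s ^ (p + 1) = k 1 s ^ (p - 1) * k 1 s ^ 2 := fun s hs => by
    rw [← Real.rpow_add_natCast (hk s hs).ne']; ring_nf
  have hsecond (h : ∀ s ∈ J, derivWithin (k 1) J s = 0) :
      ∀ s ∈ J, derivWithin (derivWithin (k 1) J) J s = 0 := fun s hs => by
    rw [derivWithin_congr h (h s hs), derivWithin_fun_const]
    rfl
  constructor
  · rintro ⟨h1, h⟩
    have hd : ∀ s ∈ J, derivWithin (k 1) J s = 0 := fun s hs => by
      have := h1 s hs
      have hp' : 1 - 2 * p ≠ 0 := fun h => hp (by linarith)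
      simpa [hp', hpow s hs] using this.symm
    refine ⟨?_, fun s hs => ?_, fun s hs => ?_, fun s hs => ?_, fun s hs j hj hjn => ?_⟩
    · obtain ⟨s₀, hs₀⟩ := hJ.nonempty
      refine ⟨k 1 s₀, (hk s₀ hs₀).ne', fun s hs => ?_⟩
      exact hJo.convex.is_const_of_fderivWithin_eq_zero
        ((hF.contDiffOn_curvature 1).differentiableOn (by simp))
        (fun t ht => by
          ext
          exact hd t ht) hs hs₀
    · have := h.eq_two s hs
      rw [hd s hs, hsecond hd s hs, e2 s hs] at this
      refine mul_left_cancel₀ (hpow s hs) ?_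
      linarith
    · have := h.eq_three s hs
      rw [hd s hs] at this
      refine mul_left_cancel₀ (hpow s hs) ?_
      linarith
    · have := h.eq_four s hs
      refine mul_left_cancel₀ (hpow s hs) ?_
      linarith
    · exact (mul_eq_zero.1 (h.eq_rest s hs j hj hjn).symm).resolve_left (hpow s hs)
  · intro h
    obtain ⟨c, -, hc⟩ := h.eq_one
    have hd : ∀ s ∈ J, derivWithin (k 1) J s = 0 := fun s hs => by
      rw [derivWithin_congr hc (hc s hs), derivWithin_fun_const]
      rfl
    refine ⟨fun s hs => by rw [hd s hs, mul_zero], fun s hs => ?_, fun s hs => ?_, fun s hs => ?_,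
      fun s hs j hj hjn => ?_⟩
    · rw [hd s hs, hsecond hd s hs, e2 s hs, ← h.eq_two s hs]
      ring
    · rw [hd s hs, h.eq_three s hs]
      ring
    · rw [← h.eq_four s hs]
      ring
    · rw [h.eq_rest s hs j hj hjn, mul_zero]

/-- For `p = 1/2` the equations of the elastic system are those of `HalfSystem` multiplied by powers
of `k₁`. -/
theorem pElasticSystem_half_iff (hk : ∀ s ∈ J, 0 < k 1 s) :
    PElasticSystem nabla (1 / 2) J γ F k ↔ HalfSystem nabla J γ F k := by
  -- All powers of `k₁` are written as `k₁ ^ (1/2 - 2)` times an integral power.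
  have hne : ∀ s ∈ J, k 1 s ≠ 0 := fun s hs => (hk s hs).ne'
  have hpow : ∀ s ∈ J, k 1 s ^ ((1 : ℝ) / 2 - 2) ≠ 0 := fun s hs =>
    (Real.rpow_pos_of_pos (hk s hs) _).ne'
  have e1 : ∀ s ∈ J, k 1 s ^ ((1 : ℝ) / 2 - 1) = k 1 s ^ ((1 : ℝ) / 2 - 2) * k 1 s := fun s hs => by
    rw [← Real.rpow_add_one (hne s hs)]; norm_num
  have e2 : ∀ s ∈ J, k 1 s ^ ((1 : ℝ) / 2 + 1) = k 1 s ^ ((1 : ℝ) / 2 - 2) * k 1 s ^ 3 :=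
    fun s hs => by rw [← Real.rpow_add_natCast (hne s hs)]; norm_num
  have e3 : ∀ s ∈ J, k 1 s ^ ((1 : ℝ) / 2 - 3) = k 1 s ^ ((1 : ℝ) / 2 - 2) * (k 1 s)⁻¹ :=
    fun s hs => by rw [← Real.rpow_neg_one, ← Real.rpow_add (hk s hs)]; norm_num
  constructor
  · intro h
    refine ⟨fun s hs => ?_, fun s hs => ?_, fun s hs => ?_, fun s hs j hj hjn => ?_⟩ <;>
      refine mul_left_cancel₀ (hpow s hs) ?_
    · have := h.eq_two s hs
      rw [e1 s hs, e2 s hs, e3 s hs] at this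
      linear_combination -this
    · have := h.eq_three s hs
      rw [e1 s hs] at this
      linear_combination -this
    · have := h.eq_four s hs
      rw [e1 s hs] at this
      refine mul_left_cancel₀ (hne s hs) ?_
      linear_combination -this
    · have := h.eq_rest s hs j hj hjn
      rw [e1 s hs] at this
      refine mul_left_cancel₀ (hne s hs) ?_
      linear_combination -this
  · intro h
    refine ⟨fun s hs => ?_, fun s hs => ?_, fun s hs => ?_, fun s hs j hj hjn => ?_⟩
    · rw [e1 s hs, e2 s hs, e3 s hs]
      linear_combination -(k 1 s ^ ((1 : ℝ) / 2 - 2)) * h.eq_one s hs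
    · rw [e1 s hs]
      linear_combination -(k 1 s ^ ((1 : ℝ) / 2 - 2)) * h.eq_two s hs
    · linear_combination -(k 1 s ^ ((1 : ℝ) / 2 - 1)) * h.eq_three s hs
    · rw [h.eq_rest s hs j hj hjn, mul_zero]

lemma tangentialEquation_half : TangentialEquation (1 / 2) J k := fun s _ => by norm_num

lemma IsFrenetFrame.not_isGeodesic (hF : IsFrenetFrame nabla J γ F k) (hn : 2 ≤ n)
    (hJ : J.Nonempty) (hk : ∀ s ∈ J, 0 < k 1 s) : ¬ IsGeodesic nabla J γ := by
  obtain ⟨s, hs⟩ := hJ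
  intro h
  have h0 := h s hs
  rw [hF.tension_eq hs, smul_eq_zero] at h0
  have h2 := hF.norm_frame hs one_le_two hn
  rcases h0 with h0 | h0
  · exact (hk s hs).ne' h0
  · rw [h0, norm_zero] at h2
    exact zero_ne_one h2

end Algebra

/-! ### The flat connection of Euclidean space -/

section Flat

variable {n : ℕ}

lemma mdifferentiableAt_vectorField_iff {V : (x : Rn n) → TangentSpace (𝓡 n) x} {x : Rn n} :
    MDifferentiableAt (𝓡 n) (𝓡 n).tangent (fun y => (⟨y, V y⟩ : TangentBundle (𝓡 n) (Rn n))) x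
      ↔ DifferentiableAt ℝ (fun y => (V y : Rn n)) x := by
  have h : (fun y => (trivializationAt (Rn n) (TangentSpace (𝓡 n)) x
      (⟨y, V y⟩ : TangentBundle (𝓡 n) (Rn n))).2) = fun y => (V y : Rn n) := by
    funext y
    simp
    rfl
  rw [mdifferentiableAt_section, h]
  exact mdifferentiableAt_iff_differentiableAt

lemma mvfderiv_eq_fderiv {f : Rn n → ℝ} {x : Rn n} : mvfderiv (𝓡 n) f x = fderiv ℝ f x := by
  ext v
  simp only [mvfderiv, mfderiv_eq_fderiv]
  rfl

/-- The flat connection of `ℝⁿ`: `∇_v Y` is the directional derivative of `Y`. -/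
noncomputable def flatConnection (n : ℕ) : Connection n (Rn n) where
  toFun Y x := fderiv ℝ (fun y => (Y y : Rn n)) x
  isCovariantDerivativeOnUniv :=
    { add := fun {σ σ' x} hσ hσ' _ => by
        rw [mdifferentiableAt_vectorField_iff] at hσ hσ'
        exact fderiv_add hσ hσ'
      leibniz := fun {σ g x} hσ hg _ => by
        rw [mdifferentiableAt_vectorField_iff] at hσ
        rw [mvfderiv_eq_fderiv]
        exact fderiv_smul (mdifferentiableAt_iff_differentiableAt.1 hg) hσ }

/-- The parallel vector field on `ℝⁿ` with value `v`. -/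
def constField {x : Rn n} (v : TangentSpace (𝓡 n) x) : (y : Rn n) → TangentSpace (𝓡 n) y :=
  fun _ => v

lemma extend_eq_constField {x : Rn n} (v : TangentSpace (𝓡 n) x) :
    (extend (Rn n) v : (y : Rn n) → TangentSpace (𝓡 n) y) = constField v := by
  funext y
  have h := TangentBundle.symmL_model_space (𝕜 := ℝ) (F := Rn n) x y
  have h2 := Trivialization.symmL_apply (R := ℝ) (trivializationAt (Rn n) (Tan n (Rn n)) x)
    (b := y) (mem_univ y) ((trivializationAt (Rn n) (Tan n (Rn n)) x) ⟨x, v⟩).2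
  rw [extend, ← h2]
  erw [h]
  simp
  rfl

lemma flatConnection_constField {x : Rn n} (v : TangentSpace (𝓡 n) x) (y : Rn n) :
    flatConnection n (constField v) y = 0 :=
  fderiv_const_apply (𝕜 := ℝ) (E := Rn n) (F := Rn n) v

lemma curvature_flatConnection (x : Rn n) (u v w : TangentSpace (𝓡 n) x) :
    curvature (flatConnection n) x u v w = 0 := by
  have h0 : (fun y => (0 : TangentSpace (𝓡 n) y)) = (0 : (y : Rn n) → TangentSpace (𝓡 n) y) := rfl
  simp only [curvature, extend_eq_constField, flatConnection_constField, zero_apply, h0,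
    CovariantDerivative.zero, Pi.zero_apply, sub_zero]

lemma curvatureComponent_flatConnection {γ : ℝ → Rn n}
    {F : ℕ → (s : ℝ) → TangentSpace (𝓡 n) (γ s)} (a b c d : ℕ) (s : ℝ) :
    curvatureComponent (flatConnection n) γ F a b c d s = 0 := by
  rw [curvatureComponent, curvature_flatConnection, inner_zero_left]

lemma covDerivAlong_flatConnection {γ : ℝ → Rn n} {V : (s : ℝ) → TangentSpace (𝓡 n) (γ s)}
    {s : ℝ} :
    covDerivAlong (flatConnection n) univ γ V s = deriv (fun t => (V t : Rn n)) s := by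
  have h := TangentBundle.symmL_model_space (𝕜 := ℝ) (F := Rn n) (γ s) (γ s)
  have hc : coords (γ s) γ V = fun t => (V t : Rn n) := by
    funext t
    simp [coords]
    rfl
  rw [covDerivAlong_def, extend_eq_constField, flatConnection_constField, derivWithin_univ, hc,
    zero_apply, add_zero]
  exact DFunLike.congr_fun h _

set_option synthInstance.maxHeartbeats 400000 in
lemma isLeviCivita_flatConnection : IsLeviCivita (flatConnection n) where
  smooth := by
    refine ⟨⟨fun {σ} hσ => ?_⟩⟩
    have h1 : ContDiff ℝ ∞ (fun y => (σ y : Rn n)) := by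
      rw [← contMDiff_vectorSpace_iff_contDiff]
      exact (contMDiffOn_univ.1 hσ)
    have h2 : ContDiff ℝ ∞ (fderiv ℝ (fun y => (σ y : Rn n))) := h1.fderiv_right (by simp)
    intro x _
    rw [contMDiffWithinAt_univ, contMDiffAt_section]
    convert! h2.contMDiff x with y
    ext v
    simp [hom_trivializationAt_apply, ContinuousLinearMap.inCoordinates]
    rfl
  torsion_free := by
    rw [CovariantDerivative.torsion_eq_zero_iff]
    intro X Y x _ _
    rw [← VectorField.mlieBracketWithin_univ, VectorField.mlieBracketWithin_eq_lieBracketWithin]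
    exact (congrFun (VectorField.lieBracketWithin_univ (𝕜 := ℝ) (E := Rn n)) x).symm
  metric := by
    rw [CovariantDerivative.isMetricCompatible_iff]
    intro x X σ τ _ hσ hτ
    rw [mvfderiv_eq_fderiv]
    have hσ' := mdifferentiableAt_vectorField_iff.1 hσ
    have hτ' := mdifferentiableAt_vectorField_iff.1 hτ
    have h := fderiv_inner_apply ℝ hσ' hτ' (X x)
    rw [add_comm] at h
    exact h

end Flat

/-! ### The catenary -/

section Catenary

/-- The standard basis vector `e i` of `ℝⁿ`, with the convention that it vanishes for `n ≤ i`. -/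
noncomputable def stdVec (n i : ℕ) : Rn n :=
  if h : i < n then EuclideanSpace.single ⟨i, h⟩ 1 else 0

lemma inner_stdVec {n i j : ℕ} (hi : i < n) :
    inner ℝ (stdVec n i) (stdVec n j) = if i = j then (1 : ℝ) else 0 := by
  rcases lt_or_ge j n with hj | hj
  · rw [stdVec, stdVec, dif_pos hi, dif_pos hj, EuclideanSpace.inner_single_left]
    simp [Fin.ext_iff]
  · rw [if_neg (by omega)]
    simp [stdVec, hj.not_gt]

/-- `1 / √(1 + s²)`, the cosine of the angle between the catenary and its axis direction. -/
noncomputable def catCos (s : ℝ) : ℝ := (√(1 + s ^ 2))⁻¹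

lemma catCos_sq (s : ℝ) : catCos s ^ 2 * (1 + s ^ 2) = 1 := by
  have h : (0 : ℝ) < 1 + s ^ 2 := by positivity
  rw [catCos, inv_pow, Real.sq_sqrt h.le, inv_mul_cancel₀ h.ne']

lemma hasDerivAt_sqrt_one_add_sq (s : ℝ) :
    HasDerivAt (fun s : ℝ => √(1 + s ^ 2)) (s * catCos s) s := by
  have h : (1 + s ^ 2 : ℝ) ≠ 0 := by positivity
  convert! (((hasDerivAt_id s).pow 2).const_add 1).sqrt h using 1
  simp [catCos]
  ring

lemma hasDerivAt_catCos (s : ℝ) : HasDerivAt catCos (-s * catCos s ^ 3) s := by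
  have h : √(1 + s ^ 2) ≠ 0 := by positivity
  convert! (hasDerivAt_sqrt_one_add_sq s).inv h using 1
  simp [catCos]
  field_simp

lemma contDiff_catCos : ContDiff ℝ ∞ catCos := by
  have h : ∀ s : ℝ, (1 + s ^ 2 : ℝ) ≠ 0 := fun s => by positivity
  have h' : ∀ s : ℝ, √(1 + s ^ 2) ≠ 0 := fun s => by positivity
  exact (ContDiff.sqrt (by fun_prop) h).inv h'

variable (n : ℕ)

/-- The catenary in the plane spanned by the first two coordinate directions of `ℝⁿ`,
parametrized by arclength. -/
noncomputable def catenary (s : ℝ) : Rn n :=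
  Real.arsinh s • stdVec n 0 + √(1 + s ^ 2) • stdVec n 1

/-- The unit tangent of the catenary. -/
noncomputable def catTangent (s : ℝ) : Rn n :=
  catCos s • stdVec n 0 + (s * catCos s) • stdVec n 1

/-- The unit normal of the catenary in its plane. -/
noncomputable def catNormal (s : ℝ) : Rn n :=
  (-(s * catCos s)) • stdVec n 0 + catCos s • stdVec n 1

lemma hasDerivAt_catenary (s : ℝ) : HasDerivAt (catenary n) (catTangent n s) s :=
  ((Real.hasDerivAt_arsinh s).smul_const _).add ((hasDerivAt_sqrt_one_add_sq s).smul_const _)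

lemma hasDerivAt_mul_catCos (s : ℝ) : HasDerivAt (fun s => s * catCos s) (catCos s ^ 3) s := by
  convert! (hasDerivAt_id s).mul (hasDerivAt_catCos s) using 1
  simp only [id]
  linear_combination catCos s * catCos_sq s

lemma hasDerivAt_catTangent (s : ℝ) :
    HasDerivAt (catTangent n) (catCos s ^ 2 • catNormal n s) s := by
  convert! ((hasDerivAt_catCos s).smul_const (stdVec n 0)).add
    ((hasDerivAt_mul_catCos s).smul_const (stdVec n 1)) using 1
  simp only [catNormal]
  module

lemma hasDerivAt_catNormal (s : ℝ) :
    HasDerivAt (catNormal n) (-(catCos s ^ 2) • catTangent n s) s := by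
  convert! ((hasDerivAt_mul_catCos s).neg.smul_const (stdVec n 0)).add
    ((hasDerivAt_catCos s).smul_const (stdVec n 1)) using 1
  simp only [catTangent]
  module

/-- The Frenet frame of the catenary: tangent, normal, and the constant vectors
`e₂, …, e_{n-1}`. The value at `2` is set to zero for `n < 2`, where there is no normal. -/
noncomputable def catFrame : ℕ → ℝ → Rn n
  | 0 => fun _ => 0
  | 1 => catTangent n
  | 2 => if 2 ≤ n then catNormal n else fun _ => 0
  | i + 3 => fun _ => stdVec n (i + 2)

/-- The curvatures of the catenary: `k₁ = 1 / (1 + s²)`, the others vanish. -/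
noncomputable def catCurv : ℕ → ℝ → ℝ
  | 1 => fun s => catCos s ^ 2
  | _ => fun _ => 0

lemma inner_catFrame {n : ℕ} (hn : 2 ≤ n) (s : ℝ) {i j : ℕ} (hi : 1 ≤ i) (hin : i ≤ n)
    (hj : 1 ≤ j) (hjn : j ≤ n) :
    inner ℝ (catFrame n i s) (catFrame n j s) = if i = j then (1 : ℝ) else 0 := by
  have hs := catCos_sq s
  have hI {i j : ℕ} (hi : i < n) := inner_stdVec (n := n) (i := i) (j := j) hi
  obtain rfl | rfl | ⟨i, rfl⟩ : i = 1 ∨ i = 2 ∨ ∃ m, i = m + 3 := by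
    rcases i with _ | _ | _ | i <;> simp at hi ⊢
  all_goals
    obtain rfl | rfl | ⟨j, rfl⟩ : j = 1 ∨ j = 2 ∨ ∃ m, j = m + 3 := by
      rcases j with _ | _ | _ | j <;> simp at hj ⊢
  all_goals
    simp only [catFrame, catTangent, catNormal, hn, if_true, inner_add_left, inner_add_right,
      real_inner_smul_left, real_inner_smul_right]
    try simp only [hI (show 0 < n by omega), hI (show 1 < n by omega)]
    try rw [hI (show i + 2 < n by omega)]
    try rw [hI (show i + 2 < n by omega)]
    simp
    try first | linear_combination hs | ring

lemma contDiff_catCurv_one : ContDiff ℝ ∞ (catCurv 1) := contDiff_catCos.pow 2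

lemma contDiff_catenary : ContDiff ℝ ∞ (catenary n) := by
  have h : ∀ s : ℝ, (1 + s ^ 2 : ℝ) ≠ 0 := fun s => by positivity
  have h1 : ContDiff ℝ ∞ (fun s : ℝ => √(1 + s ^ 2)) := ContDiff.sqrt (by fun_prop) h
  exact (Real.contDiff_arsinh.smul contDiff_const).add (h1.smul contDiff_const)

lemma contDiff_catFrame (i : ℕ) : ContDiff ℝ ∞ (catFrame n i) := by
  have h := contDiff_catCos
  rcases i with _ | _ | _ | i
  · exact contDiff_const
  · exact (h.smul contDiff_const).add ((contDiff_id.mul h).smul contDiff_const)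
  · by_cases hn : 2 ≤ n
    · simp only [catFrame, hn, if_true]
      exact ((contDiff_id.mul h).neg.smul contDiff_const).add (h.smul contDiff_const)
    · simp only [catFrame, hn, if_false]
      exact contDiff_const
  · exact contDiff_const

variable {n}

lemma velocity_catenary (s : ℝ) : velocity n univ (catenary n) s = catTangent n s := by
  have h := (hasDerivAt_catenary n s).hasFDerivAt.fderiv
  rw [velocity, mfderivWithin_univ, mfderiv_eq_fderiv, h]
  exact one_smul ℝ _

lemma norm_catTangent (hn : 2 ≤ n) (s : ℝ) : ‖catTangent n s‖ = 1 := by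
  have h := inner_catFrame hn s le_rfl (one_le_two.trans hn) le_rfl (one_le_two.trans hn)
  rw [if_pos rfl, real_inner_self_eq_norm_sq] at h
  exact (pow_eq_one_iff_of_nonneg (norm_nonneg _) two_ne_zero).1 h

lemma isUnitSpeed_catenary (hn : 2 ≤ n) : IsUnitSpeed n univ (catenary n) := by
  refine ⟨(contDiff_catenary n).contMDiff.contMDiffOn, fun s _ => ?_⟩
  rw [norm_tangentSpace_vectorSpace, velocity_catenary]
  exact norm_catTangent hn s

/-- The tangent spaces of `ℝⁿ` are copies of `ℝⁿ`, so that the Frenet equations can be read as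
equations for ordinary derivatives in `ℝⁿ`. -/
lemma isFrenetFrame_catenary (hn : 2 ≤ n) :
    IsFrenetFrame (flatConnection n) univ (catenary n) (catFrame n) catCurv where
  smooth_frame i _ _ := by
    intro s _
    rw [contMDiffWithinAt_univ, Bundle.contMDiffAt_totalSpace]
    refine ⟨(contDiff_catenary n).contMDiff s, ?_⟩
    have h : (fun t => (trivializationAt (Rn n) (TangentSpace (𝓡 n)) (catenary n s)
      (⟨catenary n t, catFrame n i t⟩ : TangentBundle (𝓡 n) (Rn n))).2) = catFrame n i := by
      funext t
      simp
    rw [h]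
    exact (contDiff_catFrame n i).contMDiff s
  smooth_curvature i hi _ := by
    rcases hi.eq_or_lt with rfl | hi
    · exact contDiff_catCurv_one.contDiffOn
    · obtain ⟨m, rfl⟩ := Nat.exists_eq_add_of_le' hi
      exact contDiffOn_const
  orthonormal s _ i j hi hin hj hjn := inner_catFrame hn s hi hin hj hjn
  frame_eq_zero i s h := by
    rcases h with rfl | h
    · rfl
    · obtain ⟨m, rfl⟩ := Nat.exists_eq_add_of_le' (show 3 ≤ i by omega)
      exact dif_neg (by omega)
  curvature_eq_zero i s h := by
    match i with
    | 0 => rfl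
    | 1 => omega
    | i + 2 => rfl
  frame_one s _ := (velocity_catenary s).symm
  deriv_one s _ := by
    refine covDerivAlong_flatConnection.trans ?_
    refine (hasDerivAt_catTangent n s).deriv.trans ?_
    simp only [catFrame, hn, if_true]
    rfl
  deriv s _ i hi _ := by
    refine covDerivAlong_flatConnection.trans ?_
    obtain rfl | ⟨m, rfl⟩ : i = 2 ∨ ∃ m, i = m + 3 := by
      rcases i with _ | _ | _ | i <;> simp at hi ⊢
    · have h : catFrame n 2 = catNormal n := by simp [catFrame, hn]
      refine (congrArg (fun V => deriv V s) h).trans ?_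
      refine (hasDerivAt_catNormal n s).deriv.trans ?_
      have h0 : -(catCos s ^ 2) • catTangent n s
        = -(catCos s ^ 2) • catTangent n s + (0 : ℝ) • catFrame n 3 s := by simp
      exact h0
    · refine (hasDerivAt_const s _).deriv.trans ?_
      have h0 : (0 : Rn n) = -(0 : ℝ) • catFrame n (m + 2) s + (0 : ℝ) • catFrame n (m + 4) s := by
        simp
      rcases m with _ | m <;> exact h0

lemma deriv_catCurv_one : deriv (catCurv 1) = fun s => -2 * s * catCos s ^ 4 := by
  funext s
  have h : HasDerivAt (catCurv 1) _ s := (hasDerivAt_catCos s).pow 2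
  rw [h.deriv]
  ring

lemma deriv_deriv_catCurv_one (s : ℝ) :
    deriv (deriv (catCurv 1)) s = -2 * catCos s ^ 4 + 8 * s ^ 2 * catCos s ^ 6 := by
  rw [deriv_catCurv_one]
  have h := ((hasDerivAt_id s).const_mul (-2)).mul ((hasDerivAt_catCos s).pow 4)
  refine h.deriv.trans ?_
  simp
  ring

lemma catCurv_one_pos (s : ℝ) : 0 < catCurv 1 s := by
  have : 0 < catCos s := by unfold catCos; positivity
  exact pow_pos this 2

lemma halfSystem_catenary :
    HalfSystem (flatConnection n) univ (catenary n) (catFrame n) catCurv := by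
  have hR (a b c d : ℕ) (s : ℝ) :
      curvatureComponent (flatConnection n) (catenary n) (catFrame n) a b c d s = 0 :=
    curvatureComponent_flatConnection a b c d s
  have h2 : catCurv 2 = fun _ => 0 := rfl
  refine ⟨fun s _ => ?_, fun s _ => ?_, fun s _ => ?_, fun s _ j _ _ => hR ..⟩
  · have hc : catCos s ≠ 0 := by unfold catCos; positivity
    have hs := catCos_sq s
    rw [hR, h2, derivWithin_univ, derivWithin_univ, deriv_deriv_catCurv_one, deriv_catCurv_one]
    simp only [catCurv]
    have hinv : (catCos s ^ 2)⁻¹ * catCos s ^ 8 = catCos s ^ 6 := by field_simp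
    -- `¾ k₁⁻¹ k₁'² = 3 s² c⁶` and `-½ k₁'' = c⁴ - 4 s² c⁶`, where `c = catCos s` and `k₁ = c²`.
    linear_combination 3 * s ^ 2 * hinv - catCos s ^ 4 * hs
  · simp [hR, h2]
  · simp [hR, h2]

end Catenary

end PBiharmonic

theorem mainTheorem3 (n : ℕ) (hn : 2 ≤ n) :
    (∀ (M : Type*) [TopologicalSpace M] [T2Space M] [ChartedSpace (PBiharmonic.Rn n) M]
        [IsManifold (𝓡 n) ∞ M] [RiemannianBundle (PBiharmonic.Tan n M)]
        [IsContMDiffRiemannianBundle (𝓡 n) ∞ (PBiharmonic.Rn n) (PBiharmonic.Tan n M)]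
        (nabla : PBiharmonic.Connection n M) (_ : PBiharmonic.IsLeviCivita nabla)
        (J : Set ℝ) (_ : J.OrdConnected) (_ : J.Nontrivial)
        (γ : ℝ → M) (_ : PBiharmonic.IsUnitSpeed n J γ)
        (F : ℕ → (s : ℝ) → TangentSpace (𝓡 n) (γ s)) (k : ℕ → ℝ → ℝ)
        (_ : PBiharmonic.IsFrenetFrame nabla J γ F k) (_ : ∀ s ∈ J, 0 < k 1 s)
        (p : ℝ) (_ : 0 < p),
      (PBiharmonic.IsPBiharmonic nabla p J γ ↔
          PBiharmonic.PBiharmonicSystem nabla p J γ F k) ∧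
      (PBiharmonic.IsPElastic nabla p J γ ↔ PBiharmonic.PElasticSystem nabla p J γ F k) ∧
      (p ≠ 1 / 2 →
        (PBiharmonic.PBiharmonicSystem nabla p J γ F k ↔
          PBiharmonic.ProperBiharmonicSystem nabla J γ F k) ∧
        (PBiharmonic.ProperBiharmonicSystem nabla J γ F k ↔
          PBiharmonic.IsProperBiharmonic nabla J γ)) ∧
      (p = 1 / 2 →
        PBiharmonic.TangentialEquation p J k ∧
        (PBiharmonic.PBiharmonicSystem nabla p J γ F k ↔
          PBiharmonic.HalfSystem nabla J γ F k) ∧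
        (PBiharmonic.HalfSystem nabla J γ F k ↔ PBiharmonic.IsPElastic nabla p J γ))) ∧
    (∃ (nabla : PBiharmonic.Connection n (PBiharmonic.Rn n)) (γ : ℝ → PBiharmonic.Rn n)
        (F : ℕ → (s : ℝ) → TangentSpace (𝓡 n) (γ s)) (k : ℕ → ℝ → ℝ),
      PBiharmonic.IsLeviCivita nabla ∧ PBiharmonic.IsUnitSpeed n univ γ ∧
      PBiharmonic.IsFrenetFrame nabla univ γ F k ∧ (∀ s, 0 < k 1 s) ∧
      PBiharmonic.HalfSystem nabla univ γ F k ∧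
      PBiharmonic.IsPBiharmonic nabla (1 / 2) univ γ ∧
      ∃ s t : ℝ, k 1 s ≠ k 1 t) := by
  refine ⟨?_, ?_⟩
  · intro M _ _ _ _ _ _ nabla hL J hJo hJ γ hγ F k hF hk p _
    have hU := PBiharmonic.uniqueDiffOn_of_ordConnected hJo hJ
    have hB : ∀ q : ℝ, _ := fun q =>
      PBiharmonic.isPBiharmonic_iff_pBiharmonicSystem (p := q) hF hn hL hU hγ hk
    have hE : ∀ q : ℝ, _ := fun q =>
      PBiharmonic.isPElastic_iff_pElasticSystem (p := q) hF hn hL hU hγ hk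
    refine ⟨hB p, hE p, fun hp => ⟨?_, ?_⟩, ?_⟩
    · exact PBiharmonic.pBiharmonicSystem_iff_properBiharmonicSystem hF hJo hJ hk hp
    · -- The proper biharmonic system does not involve p, so the case p = 2 applies.
      rw [← PBiharmonic.pBiharmonicSystem_iff_properBiharmonicSystem (p := 2) hF hJo hJ hk
        (by norm_num), ← hB 2, PBiharmonic.IsProperBiharmonic]
      exact (and_iff_left (hF.not_isGeodesic hn hJ.nonempty hk)).symm
    · rintro rfl
      have hT : PBiharmonic.TangentialEquation (1 / 2) J k := PBiharmonic.tangentialEquation_half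
      have hH := PBiharmonic.pElasticSystem_half_iff (nabla := nabla) (γ := γ) (F := F) hk
      exact ⟨hT, (and_iff_right hT).trans hH, hH.symm.trans (hE _).symm⟩
  · have hF := PBiharmonic.isFrenetFrame_catenary hn
    have hk : ∀ s ∈ univ, 0 < PBiharmonic.catCurv 1 s := fun s _ => PBiharmonic.catCurv_one_pos s
    have hH := PBiharmonic.halfSystem_catenary (n := n)
    refine ⟨PBiharmonic.flatConnection n, PBiharmonic.catenary n, PBiharmonic.catFrame n,
      PBiharmonic.catCurv, PBiharmonic.isLeviCivita_flatConnection,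
      PBiharmonic.isUnitSpeed_catenary hn, hF, PBiharmonic.catCurv_one_pos, hH, ?_, 0, 1, ?_⟩
    · rw [PBiharmonic.isPBiharmonic_iff_pBiharmonicSystem hF hn
        PBiharmonic.isLeviCivita_flatConnection uniqueDiffOn_univ
        (PBiharmonic.isUnitSpeed_catenary hn) hk]
      exact ⟨PBiharmonic.tangentialEquation_half, (PBiharmonic.pElasticSystem_half_iff hk).2 hH⟩
    · norm_num [PBiharmonic.catCurv, PBiharmonic.catCos]
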